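/- Let $\mathcal A$ be a non-empty finite or countable alphabet, $X=\mathcal A^{\mathbb N}$ with its product (Borel) $\sigma$-field, and $T:X\to X$ the shift $(x_1,x_2,\dots)\mapsto(x_2,x_3,\dots)$. Let $g_n:\mathcal A\to(0,\infty)$, $n\ge 1$, and $g(x)=\prod_{n\ge 1} g_n(x_n)$. Assume that $g$ is $\ell_1$-bounded, i.e. $\sum_{k\ge 2}\|\log g_k\|_\infty<\infty$, and summable, i.e. $\sum_{a\in\mathcal A} g_1(a)<\infty$. Write $$\mathcal L_{\log g}\phi(x)=\sum_{T y=x} g(y)\phi(y),\qquad \lambda=\sum_{a\in\mathcal A}\prod_{k=1}^\infty g_k(a).$$ Let $\mu=\bigotimes_{n\ge1}\mu_n$ be the product measure and $\tilde\mu=\bigotimes_{n\ge 1}\tilde\mu_0$ the Bernoulli measure on $X$ with $$\mu_n(a)=\frac{\prod_{i=1}^n g_i(a)}{\sum_{b}\prod_{i=1}^n g_i(b)},\qquad \tilde\mu_0(a)=\frac{\prod_{i=1}^\infty g_i(a)}{\sum_{b}\prod_{i=1}^\infty g_i(b)},$$ and let $$h_\mu(x)=\lim_{n\to\infty}\prod_{j=1}^{n}\left(\frac{\sum_{a}\prod_{l=1}^j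 g_l(a)}{\sum_{a}\prod_{l=1}^\infty g_l(a)}\prod_{l=1}^\infty g_{l+j}(x_j)\right)$$ wherever this limit exists in $\mathbb R$. Then: \begin{enumerate} \item Up to equality $\mu$-a.e., there is at most one $h\in L^1(X,\mu)$ with $\mathcal L_{\log g}(h)=\lambda h$ $\mu$-a.e. and $\int h\,d\mu=1$. \item If $g$ has $\ell_2$-bounded tails, i.e. $\sum_{i=k}^\infty\sup_{a\in\mathcal A}\bigl(\sum_{j=i}^\infty\log g_j(a)\bigr)^2<\infty$ for some $k\in\mathbb N$, then $h_\mu\in L^1(X,\mu)$, $\int h_\mu\,d\mu=1$, $\mathcal L_{\log g}(h_\mu)=\lambda h_\mu$ $\mu$-a.e. (the sum converging absolutely $\mu$-a.e.), and $d\tilde\mu=h_\mu\,d\mu$. \item In general, the limit defining $h_\mu$ exists and is finite $\mu$-a.s., and $h_\mu\in L^1(X,\mu)$. Moreover, $\int h_\mu\,d\mu>0$ if and only if $\mu$ and $\tilde\mu$ are equivalent (mutually absolutely continuous); if $\int h_\mu\,d\mu=0$, then $\mu$ and $\tilde\mu$ are mutually singular. \end{enumerate} -/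

import Mathlib

open MeasureTheory Filter Topology
open scoped ENNReal

noncomputable section

namespace ProductPotential

variable {A : Type*}

/-- The one-sided full shift `X = A^ℕ`. Coordinates are indexed from `0`: `x n` is the
`(n+1)`-st letter of `x`. -/
abbrev Seq (A : Type*) : Type _ := ℕ → A

/-- The shift map, which deletes the first letter. -/
def shift (x : Seq A) : Seq A := fun n => x (n + 1)

/-- The Ruelle operator `(L_f φ)(x) = ∑_{T y = x} φ(y) exp(f(y))`. -/
def ruelle (f φ : Seq A → ℝ) (x : Seq A) : ℝ :=
  ∑' y : {y : Seq A // shift y = x}, φ y * Real.exp (f y)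

/-- The sum that defines the Ruelle operator at `x` converges absolutely. -/
def RuelleConverges (f φ : Seq A → ℝ) (x : Seq A) : Prop :=
  Summable fun y : {y : Seq A // shift y = x} => φ y * Real.exp (f y)

/-- The potential of product type with factors `g`. Factors are indexed from `0`: `g n` is the
`(n+1)`-st factor, a function of the `(n+1)`-st letter. -/
def potential (g : ℕ → A → ℝ) (x : Seq A) : ℝ := ∏' n, g n (x n)

/-- `ℓ₁`-boundedness: the sup norms of the logarithms of all factors except the first one are
summable. The sum and the sup norms are taken in `[0, ∞]`. -/
def L1Bounded (g : ℕ → A → ℝ) : Prop :=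
  ∑' k, ⨆ a, ‖Real.log (g (k + 1) a)‖ₑ < ∞

/-- Summability of the first factor over the alphabet. -/
def SummablePotential (g : ℕ → A → ℝ) : Prop := Summable (g 0)

/-- `ℓ₂`-bounded tails: from some index on, the squares of the tails of `∑ log g_j` are summable
uniformly in the letter. The outer sum and the supremum are taken in `[0, ∞]`. -/
def L2BoundedTails (g : ℕ → A → ℝ) : Prop :=
  ∃ k : ℕ, ∑' i, ⨆ a, ‖∑' j, Real.log (g (k + i + j) a)‖ₑ ^ 2 < ∞

/-- The product of the first `n + 1` factors, all evaluated at the same letter `a`. -/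
def partialWeight (g : ℕ → A → ℝ) (n : ℕ) (a : A) : ℝ := ∏ i ∈ Finset.range (n + 1), g i a

/-- The product of all factors, all evaluated at the same letter `a`. -/
def fullWeight (g : ℕ → A → ℝ) (a : A) : ℝ := ∏' i, g i a

/-- The eigenvalue `λ = ∑_a ∏_k g_k(a)`. -/
def eigenvalue (g : ℕ → A → ℝ) : ℝ := ∑' a, fullWeight g a

/-- The measure on the alphabet with mass `w a / ∑_b w b` at `a`. -/
def normalizedMeasure [MeasurableSpace A] (w : A → ℝ) : Measure A :=
  Measure.sum fun a => ENNReal.ofReal (w a / ∑' b, w b) • Measure.dirac a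

/-- The product measure `μ = ⊗ μ_n`, where `μ_n` has weights proportional to
`∏_{i ≤ n} g_i(a)`. -/
def conformalMeasure [MeasurableSpace A] (g : ℕ → A → ℝ) : Measure (Seq A) :=
  Measure.infinitePi fun n => normalizedMeasure (partialWeight g n)

/-- The stationary Bernoulli measure with weights proportional to `∏_i g_i(a)`. -/
def equilibriumMeasure [MeasurableSpace A] (g : ℕ → A → ℝ) : Measure (Seq A) :=
  Measure.infinitePi fun _ : ℕ => normalizedMeasure (fullWeight g)

/-- The `j`-th factor of `h_μ` as a function of the `j`-th letter. -/
def hFactor (g : ℕ → A → ℝ) (j : ℕ) (a : A) : ℝ :=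
  (∑' b, partialWeight g j b) / (∑' b, fullWeight g b) * ∏' l, g (l + 1 + j) a

/-- The product of the first `n` factors of `h_μ`. -/
def hPartial (g : ℕ → A → ℝ) (n : ℕ) (x : Seq A) : ℝ :=
  ∏ j ∈ Finset.range n, hFactor g j (x j)

/-- The function `h_μ`: the limit of the partial products in their natural order (in general the
infinite product converges only conditionally), wherever this limit exists in `ℝ`. -/
def hMu (g : ℕ → A → ℝ) (x : Seq A) : ℝ := limUnder atTop fun n => hPartial g n x

end ProductPotential

end

/-! The factors of `hMu` are the densities of the marginals of the Bernoulli measure with respect to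
those of `μ`, so `hMu` is a limit of likelihood ratios and Kakutani's theorem on infinite product
measures applies. The ratios form a positive martingale of mean one, hence converge a.e. Their
behaviour is governed by the products of the Hellinger affinities `∫ √q dP`, each at most one. If
these products tend to `0`, Fatou applied to square roots gives limit zero, and the measures are
singular (`mutuallySingular_infinitePi`). Otherwise the square roots are Cauchy in `L²`, no mass is
lost, and the limit is the density (`infinitePi_eq_withDensity`). Since the situation is symmetric,
the measures are then equivalent. A density within `exp (±2t)` of one has affinity at least `1 -
2t²`; this quadratic loss is why `ℓ₂`-bounded tails suffice.

The eigenvalue equation for `hMu` holds preimage by preimage: after telescoping, the term of the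
letter `a` is `fullWeight g a * hMu g x`, and these weights sum to `λ` (`hMu_consSeq_mul`).

Uniqueness rests on conformality, the dual operator fixing `μ` up to the factor `λ`. It makes `h dμ`
shift-invariant for any integrable eigenfunction `h` (`setIntegral_shift_preimage`). The difference
of two normalized eigenfunctions has integral zero, and its integral over `B` equals that over the
`n`-fold preimage of `B`, which is independent of the first `n` letters; Lévy's upward theorem
forces this integral to vanish (`ae_eq_of_shift_invariant`). -/

namespace ProductPotential

open ProbabilityTheory

/-! ### Likelihood ratios of product measures as a martingale. -/

section Kakutani

variable {X : Type*} [MeasurableSpace X]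

/-- The functions `q n` are positive densities of `Q n` with respect to `P n`. -/
structure IsPosDensity (P Q : ℕ → Measure X) (q : ℕ → X → ℝ) : Prop where
  measurable : ∀ n, Measurable (q n)
  pos : ∀ n a, 0 < q n a
  eq_withDensity : ∀ n, Q n = (P n).withDensity fun a => ENNReal.ofReal (q n a)

/-- The likelihood ratio of the first `n` coordinates. -/
noncomputable def partialDensity (q : ℕ → X → ℝ) (n : ℕ) (x : ℕ → X) : ℝ :=
  ∏ j ∈ Finset.range n, q j (x j)

/-- The Hellinger affinity of the `n`-th marginals. -/
noncomputable def affinity (P : ℕ → Measure X) (q : ℕ → X → ℝ) (n : ℕ) : ℝ≥0∞ :=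
  ∫⁻ a, ENNReal.ofReal (√(q n a)) ∂P n

/-- The filtration generated by the coordinates. -/
def coordFiltration : Filtration ℕ (inferInstance : MeasurableSpace (ℕ → X)) where
  seq n := ⨆ i ∈ Set.Iio n, MeasurableSpace.comap (fun x : ℕ → X => x i) inferInstance
  mono' _ _ hmn := biSup_mono fun _ hi => lt_of_lt_of_le hi hmn
  le' _ := iSup₂_le fun i _ => (measurable_pi_apply i).comap_le

theorem measurable_coordFiltration {i n : ℕ} (h : i < n) :
    Measurable[coordFiltration (X := X) n] fun x : ℕ → X => x i := by
  rw [measurable_iff_comap_le]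
  exact le_iSup₂_of_le (f := fun i (_ : i ∈ Set.Iio n) =>
    MeasurableSpace.comap (fun x : ℕ → X => x i) inferInstance) i h le_rfl

theorem iSup_coordFiltration :
    ⨆ n, coordFiltration (X := X) n = MeasurableSpace.pi := by
  apply le_antisymm (iSup_le fun n => coordFiltration.le n)
  refine iSup_le fun i => ?_
  exact le_iSup_of_le (i + 1) (measurable_coordFiltration (Nat.lt_succ_self i)).comap_le

theorem partialDensity_pos {P Q : ℕ → Measure X} {q : ℕ → X → ℝ} (h : IsPosDensity P Q q)
    (n : ℕ) (x : ℕ → X) :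
    0 < partialDensity q n x :=
  Finset.prod_pos fun _ _ => h.pos _ _

theorem measurable_partialDensity {P Q : ℕ → Measure X} {q : ℕ → X → ℝ}
    (h : IsPosDensity P Q q) (n : ℕ) :
    Measurable (partialDensity q n) :=
  Finset.measurable_fun_prod _ fun j _ => (h.measurable j).comp (measurable_pi_apply j)

theorem lintegral_density {P Q : ℕ → Measure X} {q : ℕ → X → ℝ} [∀ n, IsProbabilityMeasure (Q n)]
    (h : IsPosDensity P Q q) (n : ℕ) :
    ∫⁻ a, ENNReal.ofReal (q n a) ∂P n = 1 := by
  have h1 : Q n Set.univ = 1 := measure_univ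
  rwa [h.eq_withDensity, withDensity_apply _ MeasurableSet.univ, Measure.restrict_univ] at h1

variable (P : ℕ → Measure X) [∀ n, IsProbabilityMeasure (P n)]

theorem lintegral_prod_infinitePi (s : Finset ℕ) {f : ℕ → X → ℝ≥0∞}
    (hf : ∀ n, Measurable (f n)) :
    ∫⁻ x, ∏ i ∈ s, f i (x i) ∂Measure.infinitePi P = ∏ i ∈ s, ∫⁻ a, f i a ∂P i := by
  rw [lintegral_prod_eq_prod_lintegral_of_indepFun (μ := Measure.infinitePi P) s
    (fun i x => f i (x i)) (iIndepFun_infinitePi hf) (fun i => (hf i).comp (measurable_pi_apply i))]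
  refine Finset.prod_congr rfl fun i _ => ?_
  exact (measurePreserving_eval_infinitePi P i).lintegral_comp (hf i)

theorem indep_coordFiltration_tail (n : ℕ) :
    Indep (coordFiltration (X := X) n)
      (⨆ i ∈ Set.Ici n, MeasurableSpace.comap (fun x : ℕ → X => x i) inferInstance)
      (Measure.infinitePi P) := by
  have h := iIndepFun_infinitePi (P := P) (X := fun _ a => a) fun _ => measurable_id
  rw [iIndepFun_iff_iIndep] at h
  refine indep_iSup_of_disjoint (fun i => (measurable_pi_apply i).comap_le) h ?_
  exact Set.disjoint_left.2 fun i hi hi' => not_lt.2 (Set.mem_Ici.1 hi') (Set.mem_Iio.1 hi)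

theorem measurable_shift_iterate_tail (n : ℕ) :
    Measurable[⨆ i ∈ Set.Ici n, MeasurableSpace.comap (fun x : ℕ → X => x i) inferInstance]
      fun (x : ℕ → X) i => x (n + i) := by
  rw [@measurable_pi_iff]
  intro i
  rw [measurable_iff_comap_le]
  exact le_iSup₂_of_le (f := fun i (_ : i ∈ Set.Ici n) =>
    MeasurableSpace.comap (fun x : ℕ → X => x i) inferInstance) (n + i)
    (Nat.le_add_right n i) le_rfl

variable {P} {Q : ℕ → Measure X} {q : ℕ → X → ℝ}

variable [∀ n, IsProbabilityMeasure (Q n)]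

theorem affinity_le_one (h : IsPosDensity P Q q) (n : ℕ) : affinity P q n ≤ 1 := by
  have key : ∀ a, 2 * ENNReal.ofReal (√(q n a)) ≤ 1 + ENNReal.ofReal (q n a) := by
    intro a
    rw [← ENNReal.ofReal_one, ← ENNReal.ofReal_add zero_le_one (h.pos n a).le,
      show (2 : ℝ≥0∞) = ENNReal.ofReal 2 by simp, ← ENNReal.ofReal_mul (by norm_num)]
    apply ENNReal.ofReal_le_ofReal
    nlinarith [Real.sq_sqrt (h.pos n a).le, sq_nonneg (√(q n a) - 1)]
  have := lintegral_mono (μ := P n) key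
  rw [lintegral_const_mul _ (by have := h.measurable n; fun_prop),
    lintegral_add_left measurable_const, lintegral_density h, lintegral_one, measure_univ,
    one_add_one_eq_two] at this
  have h2 : (2 : ℝ≥0∞) * affinity P q n ≤ 2 * 1 := by simpa [affinity] using this
  exact (ENNReal.mul_le_mul_iff_right (by simp) (by simp)).1 h2

/-- Boxes determine an infinite product measure. By independence the integral factors, and each
coordinate below `n` outside `s` contributes the total mass one of its `Q`-marginal. -/
theorem lintegral_box_partialDensity (h : IsPosDensity P Q q) {s : Finset ℕ} {n : ℕ}
    (hs : s ⊆ Finset.range n) {t : ℕ → Set X} (ht : ∀ i, MeasurableSet (t i)) :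
    ∫⁻ x in Set.pi s t, ENNReal.ofReal (partialDensity q n x) ∂Measure.infinitePi P
      = ∏ i ∈ s, Q i (t i) := by
  classical
  let f : ℕ → X → ℝ≥0∞ := fun i a =>
    (if i ∈ s then (t i).indicator 1 a else 1) * ENNReal.ofReal (q i a)
  have hf : ∀ i, Measurable (f i) := by
    intro i
    refine Measurable.mul ?_ (h.measurable i).ennreal_ofReal
    split_ifs
    · exact measurable_one.indicator (ht i)
    · exact measurable_const
  have hbox : MeasurableSet (Set.pi (s : Set ℕ) t) :=
    MeasurableSet.pi s.countable_toSet fun i _ => ht i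
  rw [← lintegral_indicator hbox]
  have e : ∀ x, (Set.pi (s : Set ℕ) t).indicator
      (fun x => ENNReal.ofReal (partialDensity q n x)) x = ∏ i ∈ Finset.range n, f i (x i) := by
    intro x
    simp only [f, Finset.prod_mul_distrib, partialDensity]
    by_cases hx : x ∈ Set.pi (s : Set ℕ) t
    · rw [Set.indicator_of_mem hx, ENNReal.ofReal_prod_of_nonneg fun i _ => (h.pos _ _).le]
      have h1 : ∏ i ∈ Finset.range n, (if i ∈ s then (t i).indicator (1 : X → ℝ≥0∞) (x i) else 1)
          = 1 := by
        refine Finset.prod_eq_one fun i _ => ?_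
        split_ifs with hi
        · simp [Set.indicator_of_mem (hx i hi)]
        · rfl
      rw [h1, one_mul]
    · rw [Set.indicator_of_notMem hx]
      simp only [Set.mem_pi, not_forall] at hx
      obtain ⟨i, hi, hxi⟩ := hx
      rw [Finset.prod_eq_zero (hs hi) (by simp [Finset.mem_coe.1 hi, hxi]), zero_mul]
  rw [lintegral_congr e, lintegral_prod_infinitePi P _ hf, ← Finset.prod_subset hs]
  · refine Finset.prod_congr rfl fun i hi => ?_
    simp only [f, hi, if_true]
    rw [h.eq_withDensity, withDensity_apply _ (ht i), ← lintegral_indicator (ht i)]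
    refine lintegral_congr fun a => ?_
    by_cases ha : a ∈ t i <;> simp [ha]
  · intro i _ hi
    simp only [f, hi, if_false, one_mul]
    exact lintegral_density h i

theorem lintegral_partialDensity (h : IsPosDensity P Q q) (n : ℕ) :
    ∫⁻ x, ENNReal.ofReal (partialDensity q n x) ∂Measure.infinitePi P = 1 := by
  simpa using lintegral_box_partialDensity h (n := n) (Finset.empty_subset _)
    (t := fun _ => Set.univ) fun _ => MeasurableSet.univ

theorem integrable_partialDensity (h : IsPosDensity P Q q) (n : ℕ) :
    Integrable (partialDensity q n) (Measure.infinitePi P) := by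
  refine ⟨(measurable_partialDensity h n).aestronglyMeasurable, ?_⟩
  rw [hasFiniteIntegral_iff_ofReal (ae_of_all _ fun x => (partialDensity_pos h n x).le),
    lintegral_partialDensity h]
  exact ENNReal.one_lt_top

theorem integrable_density_comp_eval (h : IsPosDensity P Q q) (n : ℕ) :
    Integrable (fun x : ℕ → X => q n (x n)) (Measure.infinitePi P) := by
  refine (measurePreserving_eval_infinitePi P n).integrable_comp_of_integrable (g := q n) ?_
  refine ⟨(h.measurable n).aestronglyMeasurable, ?_⟩
  rw [hasFiniteIntegral_iff_ofReal (ae_of_all _ fun x => (h.pos n x).le), lintegral_density h]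
  exact ENNReal.one_lt_top

theorem integral_density_comp_eval (h : IsPosDensity P Q q) (n : ℕ) :
    ∫ x, q n (x n) ∂Measure.infinitePi P = 1 := by
  rw [integral_eq_lintegral_of_nonneg_ae (ae_of_all _ fun x => (h.pos n _).le)
    (integrable_density_comp_eval h n).1,
    (measurePreserving_eval_infinitePi P n).lintegral_comp
      (f := fun a => ENNReal.ofReal (q n a)) (h.measurable n).ennreal_ofReal,
    lintegral_density h, ENNReal.toReal_one]

theorem martingale_partialDensity (h : IsPosDensity P Q q) :
    Martingale (partialDensity q) coordFiltration (Measure.infinitePi P) := by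
  have hadp : ∀ n, StronglyMeasurable[coordFiltration (X := X) n] (partialDensity q n) := by
    intro n
    refine Measurable.stronglyMeasurable ?_
    refine Finset.measurable_fun_prod _ fun j hj => ?_
    exact (h.measurable j).comp (measurable_coordFiltration (Finset.mem_range.1 hj))
  refine martingale_nat hadp (integrable_partialDensity h) fun n => ?_
  have e : partialDensity q (n + 1) = partialDensity q n * fun x => q n (x n) := by
    funext x
    simp [partialDensity, Finset.prod_range_succ]
  have h1 := condExp_mul_of_stronglyMeasurable_left (μ := Measure.infinitePi P) (hadp n)
    (by rw [← e]; exact integrable_partialDensity h (n + 1)) (integrable_density_comp_eval h n)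
  have h2 := condExp_indep_eq (μ := Measure.infinitePi P)
    (m₁ := ⨆ i ∈ Set.Ici n, MeasurableSpace.comap (fun x : ℕ → X => x i) inferInstance)
    (f := fun x => q n (x n))
    (iSup₂_le fun i _ => (measurable_pi_apply i).comap_le) (coordFiltration.le n)
    (by
      refine Measurable.stronglyMeasurable ((h.measurable n).comp ?_)
      -- The `n`-th letter is the first letter of the `n`-fold shift, so it belongs to the tail from
      -- `n` on.
      exact (measurable_pi_apply 0).comp (measurable_shift_iterate_tail n))
    (indep_coordFiltration_tail P n).symm
  rw [e]
  filter_upwards [h1, h2] with x hx1 hx2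
  rw [hx1, Pi.mul_apply, hx2, integral_density_comp_eval h, mul_one]

theorem ae_exists_tendsto_partialDensity (h : IsPosDensity P Q q) :
    ∀ᵐ x ∂Measure.infinitePi P, ∃ c, Tendsto (fun n => partialDensity q n x) atTop (𝓝 c) := by
  refine (martingale_partialDensity h).submartingale.exists_ae_tendsto_of_bdd (R := 1) fun n => ?_
  rw [eLpNorm_one_eq_lintegral_enorm]
  simp_rw [Real.enorm_eq_ofReal (partialDensity_pos h n _).le]
  rw [lintegral_partialDensity h]
  simp

end Kakutani

/-! ### Hellinger affinities and Kakutani's dichotomy. -/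

section KakutaniDichotomy

variable {X : Type*} [MeasurableSpace X] {P Q : ℕ → Measure X} {q : ℕ → X → ℝ}

theorem IsPosDensity.symm (h : IsPosDensity P Q q) :
    IsPosDensity Q P fun n a => (q n a)⁻¹ where
  measurable n := (h.measurable n).inv
  pos n a := inv_pos.2 (h.pos n a)
  eq_withDensity n := by
    have hm : Measurable fun a => ENNReal.ofReal (q n a) := (h.measurable n).ennreal_ofReal
    rw [h.eq_withDensity]
    simp_rw [ENNReal.ofReal_inv_of_pos (h.pos n _)]
    refine (withDensity_inv_same hm (ae_of_all _ fun a => ?_) (ae_of_all _ fun a => ?_)).symm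
    · simpa using h.pos n a
    · simp

/-- Because `q * √(q⁻¹) = √q`. With it, every one-sided result also applies with the two measures
exchanged. -/
theorem affinity_symm (h : IsPosDensity P Q q) (n : ℕ) :
    affinity Q (fun n a => (q n a)⁻¹) n = affinity P q n := by
  have hm := h.measurable n
  unfold affinity
  rw [h.eq_withDensity, lintegral_withDensity_eq_lintegral_mul _ (by fun_prop) (by fun_prop)]
  refine lintegral_congr fun a => ?_
  have h0 := h.pos n a
  rw [Pi.mul_apply, ← ENNReal.ofReal_mul h0.le, Real.sqrt_inv]
  congr 1
  have := Real.sqrt_pos.2 h0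
  field_simp
  exact (Real.sq_sqrt h0.le).symm

theorem partialDensity_inv {X : Type*} {q : ℕ → X → ℝ} (n : ℕ) (x : ℕ → X) :
    partialDensity (fun n a => (q n a)⁻¹) n x = (partialDensity q n x)⁻¹ := by
  simp [partialDensity]

variable {H : (ℕ → X) → ℝ}

theorem aemeasurable_limit (h : IsPosDensity P Q q)
    (hH : ∀ᵐ x ∂Measure.infinitePi P, Tendsto (fun n => partialDensity q n x) atTop (𝓝 (H x))) :
    AEMeasurable H (Measure.infinitePi P) :=
  aemeasurable_of_tendsto_metrizable_ae' (fun n => (measurable_partialDensity h n).aemeasurable) hH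

/-- Fatou's lemma for functions of the likelihood ratios. -/
theorem lintegral_comp_limit_le
    (hH : ∀ᵐ x ∂Measure.infinitePi P, Tendsto (fun n => partialDensity q n x) atTop (𝓝 (H x)))
    {F : (ℕ → X) → ℝ → ℝ} (hF : ∀ x, Continuous (F x))
    (hFm : ∀ n, Measurable fun x => F x (partialDensity q n x)) {S : Set (ℕ → X)} {b : ℝ≥0∞}
    (hb : ∀ᶠ n in atTop,
      ∫⁻ x in S, ENNReal.ofReal (F x (partialDensity q n x)) ∂Measure.infinitePi P ≤ b) :
    ∫⁻ x in S, ENNReal.ofReal (F x (H x)) ∂Measure.infinitePi P ≤ b := by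
  calc ∫⁻ x in S, ENNReal.ofReal (F x (H x)) ∂Measure.infinitePi P
      = ∫⁻ x in S, liminf (fun n => ENNReal.ofReal (F x (partialDensity q n x))) atTop
          ∂Measure.infinitePi P := by
        refine lintegral_congr_ae ?_
        filter_upwards [ae_restrict_of_ae hH] with x hx
        exact ((ENNReal.continuous_ofReal.comp (hF x)).tendsto _ |>.comp hx).liminf_eq.symm
    _ ≤ liminf (fun n => ∫⁻ x in S, ENNReal.ofReal (F x (partialDensity q n x))
          ∂Measure.infinitePi P) atTop :=
        lintegral_liminf_le fun n => (hFm n).ennreal_ofReal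
    _ ≤ b := by
        refine (liminf_le_liminf hb).trans ?_
        simp

/-- The tails of the product of the affinities tend to one. -/
def AffinityConverges (P : ℕ → Measure X) (q : ℕ → X → ℝ) : Prop :=
  ∀ ε : ℝ, 0 < ε → ∃ N, ∀ m, N ≤ m →
    ENNReal.ofReal (1 - ε) ≤ ∏ i ∈ Finset.Ico N m, affinity P q i

theorem AffinityConverges.symm (h : IsPosDensity P Q q) (hr : AffinityConverges P q) :
    AffinityConverges Q fun n a => (q n a)⁻¹ := by
  simpa only [AffinityConverges, affinity_symm h] using hr

variable [∀ n, IsProbabilityMeasure (P n)]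

theorem lintegral_sqrt_partialDensity (h : IsPosDensity P Q q) (n : ℕ) :
    ∫⁻ x, ENNReal.ofReal (√(partialDensity q n x)) ∂Measure.infinitePi P
      = ∏ i ∈ Finset.range n, affinity P q i := by
  have hm := h.measurable
  simp only [affinity]
  rw [← lintegral_prod_infinitePi P _ (f := fun i a => ENNReal.ofReal (√(q i a)))
    (fun i => by have := hm i; fun_prop)]
  refine lintegral_congr fun x => ?_
  rw [partialDensity, Real.sqrt_prod _ fun i _ => (h.pos _ _).le,
    ENNReal.ofReal_prod_of_nonneg fun i _ => Real.sqrt_nonneg _]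

/-- Fatou for the square roots, whose integrals are the products of affinities. -/
theorem ae_limit_eq_zero (h : IsPosDensity P Q q)
    (hH : ∀ᵐ x ∂Measure.infinitePi P, Tendsto (fun n => partialDensity q n x) atTop (𝓝 (H x)))
    (hr : Tendsto (fun n => ∏ i ∈ Finset.range n, affinity P q i) atTop (𝓝 0)) :
    H =ᵐ[Measure.infinitePi P] 0 := by
  have h1 : ∫⁻ x, ENNReal.ofReal (√(H x)) ∂Measure.infinitePi P ≤ 0 := by
    refine le_of_forall_gt_imp_ge_of_dense fun b hb => ?_
    have := lintegral_comp_limit_le hH (F := fun _ y => √y) (S := Set.univ)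
      (b := b) (fun _ => by fun_prop)
      (fun n => by have := measurable_partialDensity h n; fun_prop) ?_
    · simpa using this
    · filter_upwards [hr.eventually_le_const hb] with n hn
      simpa [lintegral_sqrt_partialDensity h] using hn
  have h2 := (lintegral_eq_zero_iff' (by have := aemeasurable_limit h hH; fun_prop)).1
    (le_antisymm h1 bot_le)
  filter_upwards [h2, hH] with x hx hHx
  have h3 : 0 ≤ H x := ge_of_tendsto' hHx fun n => (partialDensity_pos h n x).le
  have h4 : √(H x) ≤ 0 := by simpa using hx
  exact le_antisymm (Real.sqrt_eq_zero'.1 (h4.antisymm (Real.sqrt_nonneg _))) h3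

theorem affinity_pos (h : IsPosDensity P Q q) (n : ℕ) : affinity P q n ≠ 0 := by
  intro h0
  have hm := h.measurable n
  unfold affinity at h0
  rw [lintegral_eq_zero_iff (by fun_prop)] at h0
  have : ∀ᵐ _ ∂P n, False := by
    filter_upwards [h0] with a ha
    have : √(q n a) ≤ 0 := by simpa using ha
    exact absurd (Real.sqrt_pos.2 (h.pos n a)) this.not_gt
  exact IsProbabilityMeasure.ne_zero (P n) (by simpa using this)

variable [∀ n, IsProbabilityMeasure (Q n)]

/-- The first `n` coordinates carry the full density, which integrates to one; only the coordinates
from `n` to `m` carry a square root. -/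
theorem lintegral_sqrt_mul_sqrt_partialDensity (h : IsPosDensity P Q q) {n m : ℕ} (hnm : n ≤ m) :
    ∫⁻ x, ENNReal.ofReal (√(partialDensity q n x) * √(partialDensity q m x))
        ∂Measure.infinitePi P = ∏ i ∈ Finset.Ico n m, affinity P q i := by
  classical
  have hm := h.measurable
  let f : ℕ → X → ℝ≥0∞ := fun i a =>
    if i < n then ENNReal.ofReal (q i a) else ENNReal.ofReal (√(q i a))
  have hf : ∀ i, Measurable (f i) := fun i => by
    have := hm i
    by_cases hi : i < n <;> simp only [f, hi, if_true, if_false] <;> fun_prop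
  have e : ∀ x, ENNReal.ofReal (√(partialDensity q n x) * √(partialDensity q m x))
      = ∏ i ∈ Finset.range m, f i (x i) := by
    intro x
    have h1 : ∏ i ∈ Finset.range n, f i (x i)
        = ∏ i ∈ Finset.range n, ENNReal.ofReal (q i (x i)) :=
      Finset.prod_congr rfl fun i hi => by simp [f, Finset.mem_range.1 hi]
    have h2 : ∏ i ∈ Finset.Ico n m, f i (x i)
        = ∏ i ∈ Finset.Ico n m, ENNReal.ofReal (√(q i (x i))) :=
      Finset.prod_congr rfl fun i hi => by simp [f, (Finset.mem_Ico.1 hi).1]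
    rw [← Finset.prod_range_mul_prod_Ico _ hnm, h1, h2,
      ← ENNReal.ofReal_prod_of_nonneg fun i _ => (h.pos _ _).le,
      ← ENNReal.ofReal_prod_of_nonneg fun i _ => Real.sqrt_nonneg _,
      ← ENNReal.ofReal_mul (Finset.prod_nonneg fun i _ => (h.pos _ _).le)]
    congr 1
    have h3 : partialDensity q m x
        = partialDensity q n x * ∏ i ∈ Finset.Ico n m, q i (x i) :=
      (Finset.prod_range_mul_prod_Ico _ hnm).symm
    rw [h3, Real.sqrt_mul (partialDensity_pos h n x).le, ← mul_assoc,
      Real.mul_self_sqrt (partialDensity_pos h n x).le, partialDensity,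
      Real.sqrt_prod _ fun i _ => (h.pos _ _).le]
  rw [lintegral_congr e, lintegral_prod_infinitePi P _ hf,
    ← Finset.prod_range_mul_prod_Ico _ hnm, Finset.prod_eq_one, one_mul]
  · refine Finset.prod_congr rfl fun i hi => ?_
    simp only [f, not_lt.2 (Finset.mem_Ico.1 hi).1, if_false, affinity]
  · intro i hi
    simp only [f, Finset.mem_range.1 hi, if_true]
    exact lintegral_density h i

/-- Expanding the square turns convergence of the affinity products into the `L²` Cauchy property of
the square roots. The additive form avoids truncated subtraction. -/
theorem lintegral_sq_sqrt_sub_sqrt (h : IsPosDensity P Q q) {n m : ℕ} (hnm : n ≤ m) :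
    ∫⁻ x, ENNReal.ofReal ((√(partialDensity q n x) - √(partialDensity q m x)) ^ 2)
        ∂Measure.infinitePi P + 2 * ∏ i ∈ Finset.Ico n m, affinity P q i = 2 := by
  have hn := measurable_partialDensity h n
  have hm := measurable_partialDensity h m
  rw [← lintegral_sqrt_mul_sqrt_partialDensity h hnm, ← lintegral_const_mul _ (by fun_prop),
    ← lintegral_add_left (by fun_prop)]
  calc _ = ∫⁻ x, (ENNReal.ofReal (partialDensity q n x) + ENNReal.ofReal (partialDensity q m x))
        ∂Measure.infinitePi P := by
        refine lintegral_congr fun x => ?_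
        have hn0 := (partialDensity_pos h n x).le
        have hm0 := (partialDensity_pos h m x).le
        rw [show (2 : ℝ≥0∞) = ENNReal.ofReal 2 by simp, ← ENNReal.ofReal_mul (by norm_num),
          ← ENNReal.ofReal_add (by positivity) (by positivity), ← ENNReal.ofReal_add hn0 hm0]
        congr 1
        nlinarith [Real.sq_sqrt hn0, Real.sq_sqrt hm0]
    _ = 2 := by
        rw [lintegral_add_left (by fun_prop), lintegral_partialDensity h,
          lintegral_partialDensity h, one_add_one_eq_two]

theorem mutuallySingular_infinitePi (h : IsPosDensity P Q q)
    (hr : Tendsto (fun n => ∏ i ∈ Finset.range n, affinity P q i) atTop (𝓝 0)) :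
    Measure.MutuallySingular (Measure.infinitePi Q) (Measure.infinitePi P) := by
  have aux : ∀ {P Q : ℕ → Measure X} {q : ℕ → X → ℝ} [∀ n, IsProbabilityMeasure (P n)]
      [∀ n, IsProbabilityMeasure (Q n)] (h : IsPosDensity P Q q)
      (hr : Tendsto (fun n => ∏ i ∈ Finset.range n, affinity P q i) atTop (𝓝 0)),
      ∀ᵐ x ∂Measure.infinitePi P, Tendsto (fun n => partialDensity q n x) atTop (𝓝 0) := by
    intro P Q q _ _ h hr
    have h1 : ∀ᵐ x ∂Measure.infinitePi P, Tendsto (fun n => partialDensity q n x) atTop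
        (𝓝 (limUnder atTop fun n => partialDensity q n x)) := by
      filter_upwards [ae_exists_tendsto_partialDensity h] with x hx
      exact tendsto_nhds_limUnder hx
    filter_upwards [h1, ae_limit_eq_zero h h1 hr] with x hx hx0
    rwa [hx0] at hx
  have hP := aux h hr
  have hQ := aux h.symm (by simpa only [affinity_symm h] using hr)
  -- The two exceptional sets cover the space: a ratio and its inverse cannot both tend to zero, as
  -- their product is one.
  refine Measure.MutuallySingular.mk (ae_iff.1 hQ) (ae_iff.1 hP) fun x _ => ?_
  by_contra hx
  simp only [Set.mem_union, Set.mem_ofPred_eq, not_or, not_not, partialDensity_inv] at hx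
  have h1 := hx.1.mul hx.2
  simp only [inv_mul_cancel₀ (partialDensity_pos h _ x).ne', mul_zero] at h1
  exact one_ne_zero (tendsto_nhds_unique tendsto_const_nhds h1)

/-- Fatou alone could lose mass. The `L²` closeness of `√H` to the square root of a partial density,
which has mass one, excludes this. -/
theorem one_le_lintegral_limit (h : IsPosDensity P Q q)
    (hH : ∀ᵐ x ∂Measure.infinitePi P, Tendsto (fun n => partialDensity q n x) atTop (𝓝 (H x)))
    (hr : AffinityConverges P q) :
    1 ≤ ∫⁻ x, ENNReal.ofReal (H x) ∂Measure.infinitePi P := by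
  set I := ∫⁻ x, ENNReal.ofReal (H x) ∂Measure.infinitePi P with hI
  have hHm := aemeasurable_limit h hH
  have hH0 : ∀ᵐ x ∂Measure.infinitePi P, 0 ≤ H x := by
    filter_upwards [hH] with x hx
    exact ge_of_tendsto' hx fun n => (partialDensity_pos h n x).le
  -- This integrates `a² ≤ (1 + δ) b² + (1 + δ⁻¹) (a - b)²`, with `a`, `b` the square roots of a
  -- partial density and of the limit. First `ε`, then `δ`, is sent to zero.
  have step : ∀ δ : ℝ, 0 < δ → ∀ ε : ℝ, 0 < ε → ε < 1 →
      (1 : ℝ≥0∞) ≤ ENNReal.ofReal (1 + δ) * I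
        + ENNReal.ofReal (1 + δ⁻¹) * ENNReal.ofReal (2 * ε) := by
    intro δ hδ ε hε hε1
    obtain ⟨N, hN⟩ := hr ε hε
    have hNm := measurable_partialDensity h N
    have hE : ∫⁻ x, ENNReal.ofReal ((√(partialDensity q N x) - √(H x)) ^ 2)
        ∂Measure.infinitePi P ≤ ENNReal.ofReal (2 * ε) := by
      have := lintegral_comp_limit_le hH
        (F := fun x y => (√(partialDensity q N x) - √y) ^ 2) (S := Set.univ)
        (b := ENNReal.ofReal (2 * ε)) (fun _ => by fun_prop)
        (fun n => by have := measurable_partialDensity h n; fun_prop) ?_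
      · simpa using this
      · filter_upwards [eventually_ge_atTop N] with m hm
        rw [Measure.restrict_univ]
        have h1 := lintegral_sq_sqrt_sub_sqrt h hm
        have h2 : 2 * ENNReal.ofReal (1 - ε) ≠ ∞ := by finiteness
        refine (ENNReal.add_le_add_iff_right h2).1 ?_
        calc _ ≤ _ := add_le_add_right (mul_le_mul_right (hN m hm) 2) _
          _ = 2 := h1
          _ = ENNReal.ofReal (2 * ε) + 2 * ENNReal.ofReal (1 - ε) := by
              rw [show (2 : ℝ≥0∞) = ENNReal.ofReal 2 by simp,
                ← ENNReal.ofReal_mul (by norm_num), ← ENNReal.ofReal_add (by positivity)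
                (by nlinarith)]
              congr 1
              ring
    calc (1 : ℝ≥0∞) = ∫⁻ x, ENNReal.ofReal (partialDensity q N x) ∂Measure.infinitePi P :=
          (lintegral_partialDensity h N).symm
      _ ≤ ∫⁻ x, (ENNReal.ofReal (1 + δ) * ENNReal.ofReal (H x) + ENNReal.ofReal (1 + δ⁻¹) *
            ENNReal.ofReal ((√(partialDensity q N x) - √(H x)) ^ 2)) ∂Measure.infinitePi P := by
          refine lintegral_mono_ae ?_
          filter_upwards [hH0] with x hx
          rw [← ENNReal.ofReal_mul (by positivity), ← ENNReal.ofReal_mul (by positivity),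
            ← ENNReal.ofReal_add (by positivity) (by positivity)]
          apply ENNReal.ofReal_le_ofReal
          have h1 := Real.sq_sqrt (partialDensity_pos h N x).le
          have h2 := Real.sq_sqrt hx
          set a := √(partialDensity q N x)
          set b := √(H x)
          rw [← h1, ← h2]
          have h3 : (1 + δ) * b ^ 2 + (1 + δ⁻¹) * (a - b) ^ 2 - a ^ 2
              = δ⁻¹ * (δ * b - (a - b)) ^ 2 := by
            field_simp
            ring
          have h4 : 0 ≤ δ⁻¹ * (δ * b - (a - b)) ^ 2 := by positivity
          linarith
      _ = ENNReal.ofReal (1 + δ) * I + ENNReal.ofReal (1 + δ⁻¹) *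
            ∫⁻ x, ENNReal.ofReal ((√(partialDensity q N x) - √(H x)) ^ 2)
              ∂Measure.infinitePi P := by
          rw [lintegral_add_left' (by fun_prop), lintegral_const_mul'' _ (by fun_prop),
            lintegral_const_mul'' _ (by fun_prop)]
      _ ≤ _ := by gcongr
  have step2 : ∀ δ : ℝ, 0 < δ → (1 : ℝ≥0∞) ≤ ENNReal.ofReal (1 + δ) * I := by
    intro δ hδ
    have ht : Tendsto (fun ε : ℝ => ENNReal.ofReal (1 + δ) * I
        + ENNReal.ofReal (1 + δ⁻¹) * ENNReal.ofReal (2 * ε)) (𝓝[>] 0)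
        (𝓝 (ENNReal.ofReal (1 + δ) * I + ENNReal.ofReal (1 + δ⁻¹) * ENNReal.ofReal (2 * 0))) := by
      refine Tendsto.mono_left ?_ nhdsWithin_le_nhds
      refine tendsto_const_nhds.add (ENNReal.Tendsto.const_mul ?_ (Or.inr (by finiteness)))
      exact (ENNReal.continuous_ofReal.comp (by fun_prop)).tendsto 0
    have := ge_of_tendsto ht (by
      filter_upwards [Ioo_mem_nhdsGT (zero_lt_one' ℝ)] with ε hε
      exact step δ hδ ε hε.1 hε.2)
    simpa using this
  rcases eq_or_ne I ∞ with hI' | hI'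
  · simp [hI']
  have ht : Tendsto (fun δ : ℝ => ENNReal.ofReal (1 + δ) * I) (𝓝[>] 0)
      (𝓝 (ENNReal.ofReal (1 + 0) * I)) := by
    refine Tendsto.mono_left ?_ nhdsWithin_le_nhds
    refine ENNReal.Tendsto.mul_const ?_ (Or.inr hI')
    exact (ENNReal.continuous_ofReal.comp (by fun_prop)).tendsto 0
  have := ge_of_tendsto ht (by
    filter_upwards [self_mem_nhdsWithin] with δ hδ
    exact step2 δ hδ)
  simpa using this

/-- Fatou bounds the mass of `H` from above on a box and on its complement. The bounds add up to one
and the total mass is at least one, so both are equalities. -/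
theorem infinitePi_eq_withDensity (h : IsPosDensity P Q q)
    (hH : ∀ᵐ x ∂Measure.infinitePi P, Tendsto (fun n => partialDensity q n x) atTop (𝓝 (H x)))
    (hr : AffinityConverges P q) :
    Measure.infinitePi Q = (Measure.infinitePi P).withDensity fun x => ENNReal.ofReal (H x) := by
  refine (Measure.eq_infinitePi Q fun s t ht => ?_).symm
  have hbox : MeasurableSet (Set.pi (s : Set ℕ) t) :=
    MeasurableSet.pi s.countable_toSet fun i _ => ht i
  rw [withDensity_apply _ hbox]
  obtain ⟨N, hN⟩ := s.exists_nat_subset_range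
  have hsub : ∀ n, N ≤ n → s ⊆ Finset.range n := fun n hn =>
    hN.trans (Finset.range_subset_range.2 hn)
  have h1 : ∫⁻ x in Set.pi s t, ENNReal.ofReal (H x) ∂Measure.infinitePi P
      ≤ ∏ i ∈ s, Q i (t i) := by
    refine lintegral_comp_limit_le hH (F := fun _ y => y)
      (fun _ => continuous_id) (measurable_partialDensity h) ?_
    filter_upwards [eventually_ge_atTop N] with n hn
    exact (lintegral_box_partialDensity h (hsub n hn) ht).le
  have hle : ∏ i ∈ s, Q i (t i) ≤ 1 := Finset.prod_le_one' fun i _ => prob_le_one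
  have h2 : ∫⁻ x in (Set.pi s t)ᶜ, ENNReal.ofReal (H x) ∂Measure.infinitePi P
      ≤ 1 - ∏ i ∈ s, Q i (t i) := by
    refine lintegral_comp_limit_le hH (F := fun _ y => y)
      (fun _ => continuous_id) (measurable_partialDensity h) ?_
    filter_upwards [eventually_ge_atTop N] with n hn
    have h3 := lintegral_add_compl (μ := Measure.infinitePi P)
      (fun x => ENNReal.ofReal (partialDensity q n x)) hbox
    rw [lintegral_partialDensity h, lintegral_box_partialDensity h (hsub n hn) ht] at h3
    rw [← h3, ENNReal.add_sub_cancel_left (hle.trans_lt ENNReal.one_lt_top).ne]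
  refine le_antisymm h1 ?_
  have h3 := one_le_lintegral_limit h hH hr
  rw [← lintegral_add_compl _ hbox] at h3
  have h4 := h3.trans (add_le_add_right h2 _)
  have h5 : 1 - ∏ i ∈ s, Q i (t i) ≠ ∞ := by finiteness
  refine (ENNReal.add_le_add_iff_right h5).1 ?_
  rwa [add_tsub_cancel_of_le hle]

theorem infinitePi_absolutelyContinuous (h : IsPosDensity P Q q) (hr : AffinityConverges P q) :
    Measure.infinitePi Q ≪ Measure.infinitePi P := by
  rw [infinitePi_eq_withDensity h (H := fun x => limUnder atTop fun n => partialDensity q n x)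
    ((ae_exists_tendsto_partialDensity h).mono fun x hx => tendsto_nhds_limUnder hx) hr]
  exact withDensity_absolutelyContinuous _ _

/-- Either the affinities have convergent product, or the partial products tend to zero. -/
theorem affinityConverges_or_tendsto_zero (h : IsPosDensity P Q q) :
    AffinityConverges P q ∨
      Tendsto (fun n => ∏ i ∈ Finset.range n, affinity P q i) atTop (𝓝 0) := by
  set c : ℕ → ℝ≥0∞ := fun n => ∏ i ∈ Finset.range n, affinity P q i with hc
  have hanti : Antitone c := antitone_nat_of_succ_le fun n => by
    simp only [hc, Finset.prod_range_succ]
    exact mul_le_of_le_one_right' (affinity_le_one h n)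
  have hlim := tendsto_atTop_iInf hanti
  rcases eq_or_ne (⨅ n, c n) 0 with h0 | h0
  · right
    rwa [h0] at hlim
  left
  intro ε hε
  set L := ⨅ n, c n
  have hc1 : ∀ n, c n ≤ 1 := fun n => Finset.prod_le_one' fun i _ => affinity_le_one h i
  have hLtop : L ≠ ∞ := ((iInf_le c 0).trans (hc1 0)).trans_lt ENNReal.one_lt_top |>.ne
  have ht : Tendsto (fun n => ENNReal.ofReal (1 - ε) * c n) atTop
      (𝓝 (ENNReal.ofReal (1 - ε) * L)) :=
    ENNReal.Tendsto.const_mul hlim (Or.inr (by finiteness))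
  have hlt : ENNReal.ofReal (1 - ε) * L < L := by
    calc ENNReal.ofReal (1 - ε) * L < 1 * L := by
          refine ENNReal.mul_lt_mul_left h0 hLtop ?_
          rw [← ENNReal.ofReal_one]
          exact (ENNReal.ofReal_lt_ofReal_iff one_pos).2 (by linarith)
      _ = L := one_mul _
  -- For such `N`, `(1 - ε) c N < L ≤ c m` for all `m ≥ N`; cancelling `c N` leaves the product over
  -- `[N, m)`.
  obtain ⟨N, hN⟩ := (ht.eventually_lt_const hlt).exists
  refine ⟨N, fun m hm => ?_⟩
  have hcN : c N ≠ 0 := Finset.prod_ne_zero_iff.2 fun i _ => affinity_pos h i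
  have hcN' : c N ≠ ∞ := ((hc1 N).trans_lt ENNReal.one_lt_top).ne
  refine (ENNReal.mul_le_mul_iff_left hcN hcN').1 (hN.le.trans ?_)
  calc L ≤ c m := iInf_le c m
    _ = (∏ i ∈ Finset.Ico N m, affinity P q i) * c N := by
        rw [mul_comm]
        exact (Finset.prod_range_mul_prod_Ico _ hm).symm

theorem one_sub_sum_le_prod {ι : Type*} (s : Finset ι) {r d : ι → ℝ} (hr0 : ∀ i ∈ s, 0 ≤ r i)
    (hr1 : ∀ i ∈ s, r i ≤ 1) (h : ∀ i ∈ s, 1 - d i ≤ r i) :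
    1 - ∑ i ∈ s, d i ≤ ∏ i ∈ s, r i := by
  classical
  induction s using Finset.induction_on with
  | empty => simp
  | insert i s hi ih =>
    simp only [Finset.forall_mem_insert] at hr0 hr1 h
    rw [Finset.sum_insert hi, Finset.prod_insert hi]
    have h1 := ih hr0.2 hr1.2 h.2
    have h2 := Finset.prod_le_one hr0.2 hr1.2
    have h3 := Finset.prod_nonneg hr0.2
    nlinarith [h.1, hr1.1, hr0.1]

/-- Since `q` has mean one, integrating `2√q = 1 + q - (√q - 1)²` cancels the first-order term, and
`|√q - 1| ≤ 2t` for `t ≤ 1`. -/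
theorem one_sub_le_affinity (h : IsPosDensity P Q q) {n : ℕ} {t : ℝ} (ht0 : 0 ≤ t) (ht1 : t ≤ 1)
    (hl : ∀ a, Real.exp (-(2 * t)) ≤ q n a) (hu : ∀ a, q n a ≤ Real.exp (2 * t)) :
    1 - 2 * t ^ 2 ≤ (affinity P q n).toReal := by
  have hm := h.measurable n
  have hq : Integrable (q n) (P n) := by
    refine ⟨hm.aestronglyMeasurable, ?_⟩
    rw [hasFiniteIntegral_iff_ofReal (ae_of_all _ fun x => (h.pos n x).le), lintegral_density h]
    exact ENNReal.one_lt_top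
  have hq1 : ∫ a, q n a ∂P n = 1 := by
    rw [integral_eq_lintegral_of_nonneg_ae (ae_of_all _ fun x => (h.pos n x).le) hq.1,
      lintegral_density h, ENNReal.toReal_one]
  have hbd : ∀ a, |√(q n a) - 1| ≤ 2 * t := by
    intro a
    have e1 : √(Real.exp (2 * t)) = Real.exp t := by
      rw [two_mul, Real.exp_add, Real.sqrt_mul_self (Real.exp_pos t).le]
    have e2 : √(Real.exp (-(2 * t))) = Real.exp (-t) := by
      rw [show -(2 * t) = -t + -t by ring, Real.exp_add,
        Real.sqrt_mul_self (Real.exp_pos (-t)).le]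
    have h1 := Real.sqrt_le_sqrt (hl a)
    have h2 := Real.sqrt_le_sqrt (hu a)
    rw [e1] at h2
    rw [e2] at h1
    have h3 := Real.abs_exp_sub_one_le (x := t) (by rwa [abs_of_nonneg ht0])
    have h4 := Real.add_one_le_exp (-t)
    rw [abs_of_nonneg ht0] at h3
    rw [abs_le]
    constructor
    · linarith
    · linarith [le_abs_self (Real.exp t - 1)]
  have hs : Integrable (fun a => √(q n a)) (P n) := by
    refine Integrable.of_bound (by fun_prop) (1 + 2 * t) (ae_of_all _ fun a => ?_)
    rw [Real.norm_of_nonneg (Real.sqrt_nonneg _)]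
    linarith [(abs_le.1 (hbd a)).2]
  have e : (affinity P q n).toReal = ∫ a, √(q n a) ∂P n := by
    rw [affinity, integral_eq_lintegral_of_nonneg_ae
      (ae_of_all _ fun x => Real.sqrt_nonneg _) hs.1]
  have hle : ∫ a, (q n a + (1 - 4 * t ^ 2)) ∂P n ≤ ∫ a, 2 * √(q n a) ∂P n := by
    refine integral_mono (hq.add (integrable_const _)) (hs.const_mul 2) fun a => ?_
    have h1 := abs_le.1 (hbd a)
    have h2 := Real.sq_sqrt (h.pos n a).le
    simp only
    nlinarith
  rw [integral_add hq (integrable_const _), hq1, integral_const_mul, ← e] at hle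
  simp at hle
  linarith

/-- Square summable bounds on the logarithms of the densities force the affinities to have a
convergent product. -/
theorem affinityConverges_of_summable (h : IsPosDensity P Q q) {t : ℕ → ℝ} (k : ℕ)
    (ht0 : ∀ n, 0 ≤ t n) (hts : Summable fun n => t n ^ 2)
    (hl : ∀ n, k ≤ n → ∀ a, Real.exp (-(2 * t n)) ≤ q n a)
    (hu : ∀ n, k ≤ n → ∀ a, q n a ≤ Real.exp (2 * t n)) : AffinityConverges P q := by
  intro ε hε
  have hs : Summable fun n => 2 * t n ^ 2 := hts.mul_left 2
  -- The affinity bound requires `t n ≤ 1`, which summability provides from some index on.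
  have h1 : ∀ᶠ n in atTop, t n ^ 2 < 1 := hts.tendsto_atTop_zero.eventually_lt_const one_pos
  obtain ⟨N₁, hN₁⟩ := eventually_atTop.1 h1
  have h2 : Tendsto (fun N => ∑' n, 2 * t (n + N) ^ 2) atTop (𝓝 0) :=
    tendsto_sum_nat_add fun n => 2 * t n ^ 2
  obtain ⟨N₂, hN₂⟩ := eventually_atTop.1 (h2.eventually_lt_const hε)
  refine ⟨max k (max N₁ N₂), fun m hm => ?_⟩
  set N := max k (max N₁ N₂)
  have hk : k ≤ N := le_max_left _ _
  have h1N : N₁ ≤ N := (le_max_left _ _).trans (le_max_right _ _)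
  have h2N : N₂ ≤ N := (le_max_right _ _).trans (le_max_right _ _)
  have hfin : ∀ i, affinity P q i ≠ ∞ := fun i =>
    ((affinity_le_one h i).trans_lt ENNReal.one_lt_top).ne
  have h3 := one_sub_sum_le_prod (Finset.Ico N m) (r := fun i => (affinity P q i).toReal)
    (d := fun i => 2 * t i ^ 2) (fun i _ => ENNReal.toReal_nonneg)
    (fun i _ => by simpa using ENNReal.toReal_mono ENNReal.one_ne_top (affinity_le_one h i))
    (fun i hi => by
      have hi' := (Finset.mem_Ico.1 hi).1
      refine one_sub_le_affinity h (ht0 i) ?_ (hl i (hk.trans hi')) (hu i (hk.trans hi'))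
      have := hN₁ i (h1N.trans hi')
      nlinarith [ht0 i])
  have h4 : ∑ i ∈ Finset.Ico N m, 2 * t i ^ 2 ≤ ∑' n, 2 * t (n + N) ^ 2 := by
    rw [Finset.sum_Ico_eq_sum_range]
    simp_rw [add_comm N]
    exact ((summable_nat_add_iff N).2 hs).sum_le_tsum (Finset.range (m - N))
      fun i _ => by positivity
  have h5 := hN₂ N h2N
  rw [ENNReal.ofReal_le_iff_le_toReal (ENNReal.prod_ne_top fun i _ => hfin i),
    ENNReal.toReal_prod]
  linarith

end KakutaniDichotomy

/-! ### Convergence, positivity and summability of the weights. -/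

section Weights

variable {A : Type*}

/-- A positive, summable potential of product type whose factors, except for the first one, have
logarithms bounded by the summable sequence `c`. -/
structure IsAdmissible (g : ℕ → A → ℝ) (c : ℕ → ℝ) : Prop where
  pos : ∀ n a, 0 < g n a
  summable_bound : Summable c
  abs_log_le : ∀ n a, |Real.log (g (n + 1) a)| ≤ c n
  summable_zero : Summable (g 0)

theorem exists_isAdmissible {g : ℕ → A → ℝ} (hpos : ∀ n a, 0 < g n a) (hbdd : L1Bounded g)
    (hsum : SummablePotential g) : ∃ c, IsAdmissible g c := by
  have hfin : ∀ n, ⨆ a, ‖Real.log (g (n + 1) a)‖ₑ ≠ ∞ := ENNReal.ne_top_of_tsum_ne_top hbdd.ne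
  refine ⟨fun n => (⨆ a, ‖Real.log (g (n + 1) a)‖ₑ).toReal, hpos,
    ENNReal.summable_toReal hbdd.ne, fun n a => ?_, hsum⟩
  rw [← Real.norm_eq_abs, ← toReal_enorm]
  exact ENNReal.toReal_mono (hfin n) (le_iSup (fun a => ‖Real.log (g (n + 1) a)‖ₑ) a)

variable {g : ℕ → A → ℝ} {c : ℕ → ℝ} (h : IsAdmissible g c)

include h

theorem IsAdmissible.bound_nonneg [Nonempty A] (n : ℕ) : 0 ≤ c n :=
  (abs_nonneg _).trans (h.abs_log_le n (Classical.arbitrary A))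

theorem IsAdmissible.summable_log (k : ℕ) (y : ℕ → A) :
    Summable fun n => Real.log (g (n + k) (y n)) := by
  rw [← summable_nat_add_iff 1]
  refine Summable.of_norm_bounded ((summable_nat_add_iff k).2 h.summable_bound) fun n => ?_
  rw [show n + 1 + k = n + k + 1 by ring]
  exact h.abs_log_le _ _

theorem IsAdmissible.multipliable (k : ℕ) (y : ℕ → A) :
    Multipliable fun n => g (n + k) (y n) :=
  Real.multipliable_of_summable_log (fun _ => h.pos _ _) (h.summable_log k y)

theorem IsAdmissible.tprod_pos (k : ℕ) (y : ℕ → A) : 0 < ∏' n, g (n + k) (y n) := by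
  rw [← Real.rexp_tsum_eq_tprod (fun _ => h.pos _ _) (h.summable_log k y)]
  exact Real.exp_pos _

theorem IsAdmissible.partialWeight_pos (n : ℕ) (a : A) : 0 < partialWeight g n a :=
  Finset.prod_pos fun _ _ => h.pos _ _

theorem IsAdmissible.fullWeight_pos (a : A) : 0 < fullWeight g a := h.tprod_pos 0 fun _ => a

theorem IsAdmissible.fullWeight_eq (n : ℕ) (a : A) :
    fullWeight g a = partialWeight g n a * ∏' l, g (l + 1 + n) a := by
  have h1 := Multipliable.prod_mul_tprod_nat_mul' (f := fun i => g i a) (k := n + 1)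
    (h.multipliable (n + 1) fun _ => a)
  rw [fullWeight, ← h1, partialWeight]
  congr 2
  funext l
  rw [add_assoc, add_comm 1 n]

theorem IsAdmissible.factor_bounds (n : ℕ) (a : A) :
    Real.exp (-c n) ≤ g (n + 1) a ∧ g (n + 1) a ≤ Real.exp (c n) := by
  have h1 := abs_le.1 (h.abs_log_le n a)
  rw [← Real.exp_log (h.pos (n + 1) a)]
  exact ⟨Real.exp_le_exp.2 h1.1, Real.exp_le_exp.2 h1.2⟩

/-- A summable majorant independent of `n`: it gives summability of all weights and dominated
convergence of the normalizing constants. -/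
theorem IsAdmissible.partialWeight_le [Nonempty A] (n : ℕ) (a : A) :
    partialWeight g n a ≤ g 0 a * Real.exp (∑' k, c k) := by
  rw [partialWeight, Finset.prod_range_succ', mul_comm]
  refine mul_le_mul_of_nonneg_left ?_ (h.pos 0 a).le
  calc ∏ k ∈ Finset.range n, g (k + 1) a ≤ ∏ k ∈ Finset.range n, Real.exp (c k) :=
        Finset.prod_le_prod (fun k _ => (h.pos _ a).le) fun k _ => (h.factor_bounds k a).2
    _ = Real.exp (∑ k ∈ Finset.range n, c k) := (Real.exp_sum _ _).symm
    _ ≤ Real.exp (∑' k, c k) :=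
        Real.exp_le_exp.2 (h.summable_bound.sum_le_tsum _ fun k _ => h.bound_nonneg k)

theorem IsAdmissible.tendsto_partialWeight (a : A) :
    Tendsto (fun n => partialWeight g n a) atTop (𝓝 (fullWeight g a)) := by
  have h1 := (h.multipliable 0 fun _ => a).hasProd.tendsto_prod_nat
  exact h1.comp (tendsto_add_atTop_nat 1)

theorem IsAdmissible.summable_partialWeight [Nonempty A] (n : ℕ) :
    Summable (partialWeight g n) :=
  Summable.of_nonneg_of_le (fun a => (h.partialWeight_pos n a).le) (h.partialWeight_le n)
    (h.summable_zero.mul_right _)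

theorem IsAdmissible.summable_fullWeight [Nonempty A] : Summable (fullWeight g) :=
  Summable.of_nonneg_of_le (fun a => (h.fullWeight_pos a).le)
    (fun a => le_of_tendsto' (h.tendsto_partialWeight a) fun n => h.partialWeight_le n a)
    (h.summable_zero.mul_right _)

theorem IsAdmissible.tsum_partialWeight_pos [Nonempty A] (n : ℕ) :
    0 < ∑' b, partialWeight g n b :=
  (h.summable_partialWeight n).tsum_pos (fun a => (h.partialWeight_pos n a).le)
    (Classical.arbitrary A) (h.partialWeight_pos n _)

theorem IsAdmissible.eigenvalue_pos [Nonempty A] : 0 < eigenvalue g :=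
  h.summable_fullWeight.tsum_pos (fun a => (h.fullWeight_pos a).le)
    (Classical.arbitrary A) (h.fullWeight_pos _)

theorem IsAdmissible.tendsto_tsum_partialWeight [Nonempty A] :
    Tendsto (fun n => ∑' b, partialWeight g n b) atTop (𝓝 (eigenvalue g)) := by
  refine tendsto_tsum_of_dominated_convergence
    (h.summable_zero.mul_right (Real.exp (∑' k, c k))) h.tendsto_partialWeight
    (Eventually.of_forall fun n a => ?_)
  rw [Real.norm_of_nonneg (h.partialWeight_pos n a).le]
  exact h.partialWeight_le n a

end Weights

/-! ### Normalized measures on the alphabet and their densities. -/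

section NormalizedMeasure

variable {A : Type*}

/-- The density of the normalized measure with weights `w'` with respect to the one with
weights `w`. -/
noncomputable def normalizedDensity (w w' : A → ℝ) (a : A) : ℝ :=
  (∑' b, w b) / (∑' b, w' b) * (w' a / w a)

/-- The exponent doubles because the ratio of the weights and the ratio of the normalizing constants
each contribute `exp (±t)`. -/
theorem normalizedDensity_bounds {w w' : A → ℝ} (hw : ∀ a, 0 < w a) (hws : Summable w)
    (hws' : Summable w') (hZ' : 0 < ∑' b, w' b) {t : ℝ}
    (hl : ∀ a, Real.exp (-t) * w a ≤ w' a) (hu : ∀ a, w' a ≤ Real.exp t * w a) (a : A) :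
    Real.exp (-(2 * t)) ≤ normalizedDensity w w' a ∧
      normalizedDensity w w' a ≤ Real.exp (2 * t) := by
  have h1 : Real.exp (-t) * ∑' b, w b ≤ ∑' b, w' b := by
    rw [← tsum_mul_left]
    exact (hws.mul_left _).tsum_le_tsum hl hws'
  have h2 : ∑' b, w' b ≤ Real.exp t * ∑' b, w b := by
    rw [← tsum_mul_left]
    exact hws'.tsum_le_tsum hu (hws.mul_left _)
  have h3 : Real.exp (-t) ≤ w' a / w a := (le_div_iff₀ (hw a)).2 (hl a)
  have h4 : w' a / w a ≤ Real.exp t := (div_le_iff₀ (hw a)).2 (hu a)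
  have h5 : Real.exp (-t) ≤ (∑' b, w b) / ∑' b, w' b := by
    rw [le_div_iff₀ hZ', Real.exp_neg, inv_mul_le_iff₀ (Real.exp_pos t)]
    exact h2
  have h6 : (∑' b, w b) / (∑' b, w' b) ≤ Real.exp t := by
    rw [div_le_iff₀ hZ', ← inv_mul_le_iff₀ (Real.exp_pos t), ← Real.exp_neg]
    exact h1
  have e1 : Real.exp (-(2 * t)) = Real.exp (-t) * Real.exp (-t) := by
    rw [← Real.exp_add]
    ring_nf
  have e2 : Real.exp (2 * t) = Real.exp t * Real.exp t := by
    rw [← Real.exp_add]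
    ring_nf
  rw [e1, e2]
  have h7 := (Real.exp_pos (-t)).le
  exact ⟨mul_le_mul h5 h3 h7 (h7.trans h5),
    mul_le_mul h6 h4 (h7.trans h3) (Real.exp_pos t).le⟩

variable [MeasurableSpace A]

theorem isProbabilityMeasure_normalizedMeasure {w : A → ℝ} (hw : ∀ a, 0 < w a)
    (hZ : 0 < ∑' b, w b) : IsProbabilityMeasure (normalizedMeasure w) := by
  constructor
  rw [normalizedMeasure, Measure.sum_apply _ MeasurableSet.univ]
  have hs : Summable w := by
    by_contra hs
    simp [tsum_eq_zero_of_not_summable hs] at hZ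
  simp only [Measure.smul_apply, measure_univ, smul_eq_mul, mul_one]
  rw [← ENNReal.ofReal_tsum_of_nonneg (fun a => (div_pos (hw a) hZ).le) (hs.div_const _),
    tsum_div_const, div_self hZ.ne', ENNReal.ofReal_one]

variable [MeasurableSingletonClass A]

theorem normalizedMeasure_singleton (w : A → ℝ) (a : A) :
    normalizedMeasure w {a} = ENNReal.ofReal (w a / ∑' b, w b) := by
  rw [normalizedMeasure, Measure.sum_apply _ (measurableSet_singleton a), tsum_eq_single a]
  · simp
  · intro b hb
    simp [hb]

variable [Countable A]

theorem isPosDensity_normalizedDensity {w w' : ℕ → A → ℝ} (hw : ∀ n a, 0 < w n a)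
    (hw' : ∀ n a, 0 < w' n a) (hZ : ∀ n, 0 < ∑' b, w n b) (hZ' : ∀ n, 0 < ∑' b, w' n b) :
    IsPosDensity (fun n => normalizedMeasure (w n)) (fun n => normalizedMeasure (w' n))
      fun n => normalizedDensity (w n) (w' n) where
  measurable n := measurable_of_countable _
  pos n a := mul_pos (div_pos (hZ n) (hZ' n)) (div_pos (hw' n a) (hw n a))
  eq_withDensity n := by
    refine Measure.ext_of_singleton fun a => ?_
    have h1 := div_pos (hw n a) (hZ n)
    rw [withDensity_apply _ (measurableSet_singleton a), lintegral_singleton,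
      normalizedMeasure_singleton, normalizedMeasure_singleton,
      ← ENNReal.ofReal_mul' h1.le]
    congr 1
    have := (hZ n).ne'
    have := (hZ' n).ne'
    have := (hw n a).ne'
    rw [normalizedDensity]
    field_simp

end NormalizedMeasure

/-! ### Kakutani's theorem applied to the Bernoulli measure and to the shifted product measure. -/

section Densities

variable {A : Type*} [Nonempty A] [MeasurableSpace A]
  {g : ℕ → A → ℝ} {c : ℕ → ℝ}

theorem IsAdmissible.isProbabilityMeasure_partialWeight (h : IsAdmissible g c) (n : ℕ) :
    IsProbabilityMeasure (normalizedMeasure (partialWeight g n)) :=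
  isProbabilityMeasure_normalizedMeasure (h.partialWeight_pos n) (h.tsum_partialWeight_pos n)

theorem IsAdmissible.isProbabilityMeasure_fullWeight (h : IsAdmissible g c) :
    IsProbabilityMeasure (normalizedMeasure (fullWeight g)) :=
  isProbabilityMeasure_normalizedMeasure h.fullWeight_pos h.eigenvalue_pos

variable [Countable A] [MeasurableSingletonClass A]

/-- The quotient of the full by the partial weight is exactly the tail product in `hFactor`. Hence
`hPartial` is a likelihood ratio. -/
theorem IsAdmissible.isPosDensity_hFactor (h : IsAdmissible g c) :
    IsPosDensity (fun n => normalizedMeasure (partialWeight g n))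
      (fun _ => normalizedMeasure (fullWeight g)) (hFactor g) := by
  have h1 := isPosDensity_normalizedDensity (w := partialWeight g) (w' := fun _ => fullWeight g)
    h.partialWeight_pos (fun _ => h.fullWeight_pos) h.tsum_partialWeight_pos
    (fun _ => h.eigenvalue_pos)
  convert h1 using 1
  funext n a
  rw [hFactor, normalizedDensity, h.fullWeight_eq n a,
    mul_div_cancel_left₀ _ (h.partialWeight_pos n a).ne']

theorem IsAdmissible.affinityConverges_hFactor (h : IsAdmissible g c) (h2 : L2BoundedTails g) :
    AffinityConverges (fun n => normalizedMeasure (partialWeight g n)) (hFactor g) := by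
  obtain ⟨k, hk⟩ := h2
  set u : ℕ → ℝ≥0∞ := fun i => ⨆ a, ‖∑' j, Real.log (g (k + i + j) a)‖ₑ ^ 2 with hu
  have hfin : ∀ n, u n ≠ ∞ := ENNReal.ne_top_of_tsum_ne_top hk.ne
  have hus : Summable fun n => (u n).toReal := ENNReal.summable_toReal hk.ne
  have := h.isProbabilityMeasure_partialWeight
  have := h.isProbabilityMeasure_fullWeight
  -- `partialWeight g n` has `n + 1` factors, so the remaining tail starts at `n + 1 = k + (n + 1 -
  -- k)`.
  have htail : ∀ n, k ≤ n → ∀ a, |∑' l, Real.log (g (l + 1 + n) a)| ≤ √(u (n + 1 - k)).toReal := by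
    intro n hn a
    apply Real.le_sqrt_of_sq_le
    have h1 : ‖∑' j, Real.log (g (k + (n + 1 - k) + j) a)‖ₑ ^ 2 ≤ u (n + 1 - k) :=
      le_iSup (fun a => ‖∑' j, Real.log (g (k + (n + 1 - k) + j) a)‖ₑ ^ 2) a
    have h3 := ENNReal.toReal_mono (hfin _) h1
    rw [ENNReal.toReal_pow, toReal_enorm, Real.norm_eq_abs] at h3
    convert h3 using 5 with l
    congr 2
    omega
  have hfull : ∀ n, k ≤ n → ∀ a,
      Real.exp (-√(u (n + 1 - k)).toReal) * partialWeight g n a ≤ fullWeight g a ∧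
      fullWeight g a ≤ Real.exp (√(u (n + 1 - k)).toReal) * partialWeight g n a := by
    intro n hn a
    have e : ∏' l, g (l + 1 + n) a = Real.exp (∑' l, Real.log (g (l + 1 + n) a)) := by
      refine (Real.rexp_tsum_eq_tprod (fun _ => h.pos _ _) ?_).symm
      simpa only [add_assoc] using h.summable_log (1 + n) fun _ => a
    have h1 := abs_le.1 (htail n hn a)
    have h3 := (h.partialWeight_pos n a).le
    rw [h.fullWeight_eq n a, e, mul_comm (partialWeight g n a)]
    exact ⟨mul_le_mul_of_nonneg_right (Real.exp_le_exp.2 h1.1) h3,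
      mul_le_mul_of_nonneg_right (Real.exp_le_exp.2 h1.2) h3⟩
  have hbd : ∀ n, k ≤ n → ∀ a, Real.exp (-(2 * √(u (n + 1 - k)).toReal)) ≤ hFactor g n a ∧
      hFactor g n a ≤ Real.exp (2 * √(u (n + 1 - k)).toReal) := by
    intro n hn a
    have e : hFactor g n a = normalizedDensity (partialWeight g n) (fullWeight g) a := by
      rw [hFactor, normalizedDensity, h.fullWeight_eq n a,
        mul_div_cancel_left₀ _ (h.partialWeight_pos n a).ne']
    rw [e]
    exact normalizedDensity_bounds (h.partialWeight_pos n) (h.summable_partialWeight n)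
      h.summable_fullWeight h.eigenvalue_pos
      (fun a => (hfull n hn a).1) (fun a => (hfull n hn a).2) a
  refine affinityConverges_of_summable h.isPosDensity_hFactor
    (t := fun n => √(u (n + 1 - k)).toReal) k (fun n => Real.sqrt_nonneg _) ?_
    (fun n hn a => (hbd n hn a).1) (fun n hn a => (hbd n hn a).2)
  simp_rw [Real.sq_sqrt ENNReal.toReal_nonneg]
  rw [← summable_nat_add_iff k]
  convert (summable_nat_add_iff 1).2 hus using 4 with n
  omega

/-- The density of the shifted product measure with respect to the product measure. -/
noncomputable def tailProduct {A : Type*} (g : ℕ → A → ℝ) (x : Seq A) : ℝ := ∏' l, g (l + 1) (x l)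

theorem IsAdmissible.tendsto_tailProduct {A : Type*} {g : ℕ → A → ℝ} (h : IsAdmissible g c)
    (x : Seq A) :
    Tendsto (fun n => ∏ l ∈ Finset.range n, g (l + 1) (x l)) atTop (𝓝 (tailProduct g x)) :=
  (h.multipliable 1 x).hasProd.tendsto_prod_nat

/-- This is the conformality of `μ` in terms of densities. Consecutive marginals differ by one
factor of `g` and a quotient of normalizing constants; the quotients telescope, and `ℓ₁`-boundedness
yields the square summability needed. -/
theorem IsAdmissible.infinitePi_succ_eq_withDensity (h : IsAdmissible g c) :
    (Measure.infinitePi fun n => normalizedMeasure (partialWeight g (n + 1))) =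
      (conformalMeasure g).withDensity fun x => ENNReal.ofReal
        ((∑' b, partialWeight g 0 b) / eigenvalue g * tailProduct g x) := by
  have := h.isProbabilityMeasure_partialWeight
  have hd := isPosDensity_normalizedDensity (w := partialWeight g)
    (w' := fun n => partialWeight g (n + 1)) h.partialWeight_pos
    (fun n => h.partialWeight_pos (n + 1)) h.tsum_partialWeight_pos
    (fun n => h.tsum_partialWeight_pos (n + 1))
  refine infinitePi_eq_withDensity hd (ae_of_all _ fun x => ?_) ?_
  · have e : ∀ n, partialDensity (fun n => normalizedDensity (partialWeight g n)
        (partialWeight g (n + 1))) n x = (∑' b, partialWeight g 0 b) /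
          (∑' b, partialWeight g n b) * ∏ l ∈ Finset.range n, g (l + 1) (x l) := by
      intro n
      induction n with
      | zero => simp [partialDensity, (h.tsum_partialWeight_pos 0).ne']
      | succ n ih =>
        rw [partialDensity, Finset.prod_range_succ, ← partialDensity, ih, normalizedDensity,
          Finset.prod_range_succ, partialWeight.eq_1 g (n + 1) (x n), Finset.prod_range_succ,
          ← partialWeight, mul_div_cancel_left₀ _ (h.partialWeight_pos n _).ne']
        have := (h.tsum_partialWeight_pos n).ne'
        have := (h.tsum_partialWeight_pos (n + 1)).ne'
        field_simp
    simp_rw [e]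
    exact (tendsto_const_nhds.div h.tendsto_tsum_partialWeight h.eigenvalue_pos.ne').mul
      (h.tendsto_tailProduct x)
  · have hbd := fun n a => normalizedDensity_bounds (t := c n) (h.partialWeight_pos n)
      (h.summable_partialWeight n) (h.summable_partialWeight (n + 1))
      (h.tsum_partialWeight_pos (n + 1))
      (fun a => by
        rw [partialWeight.eq_1 g (n + 1) a, Finset.prod_range_succ, ← partialWeight, mul_comm]
        exact mul_le_mul_of_nonneg_left (h.factor_bounds n a).1 (h.partialWeight_pos n a).le)
      (fun a => by
        rw [partialWeight.eq_1 g (n + 1) a, Finset.prod_range_succ, ← partialWeight, mul_comm]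
        exact mul_le_mul_of_nonneg_right (h.factor_bounds n a).2 (h.partialWeight_pos n a).le) a
    refine affinityConverges_of_summable hd 0 h.bound_nonneg ?_ (fun n _ a => (hbd n a).1)
      (fun n _ a => (hbd n a).2)
    have h1 := h.summable_bound.tendsto_atTop_zero.eventually_lt_const (zero_lt_one' ℝ)
    refine Summable.of_norm_bounded_eventually_nat h.summable_bound ?_
    filter_upwards [h1] with n hn
    have h0 := h.bound_nonneg n
    rw [Real.norm_of_nonneg (sq_nonneg _)]
    nlinarith

end Densities

/-! ### The eigenvalue equation for `hMu`. -/

section Ruelle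

variable {A : Type*}

/-- The sequence with first letter `a` followed by `x`. -/
def consSeq (a : A) (x : Seq A) : Seq A
  | 0 => a
  | n + 1 => x n

theorem consSeq_shift (x : Seq A) : consSeq (x 0) (shift x) = x := by
  funext n
  cases n <;> rfl

/-- The preimages of `x` under the shift are indexed by the alphabet. -/
def shiftFiberEquiv (x : Seq A) : A ≃ {y : Seq A // shift y = x} where
  toFun a := ⟨consSeq a x, rfl⟩
  invFun y := y.1 0
  left_inv _ := rfl
  right_inv := by
    rintro ⟨y, rfl⟩
    exact Subtype.ext (consSeq_shift y)

variable {g : ℕ → A → ℝ} {c : ℕ → ℝ}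

theorem IsAdmissible.tailProduct_pos (h : IsAdmissible g c) (x : Seq A) : 0 < tailProduct g x :=
  h.tprod_pos 1 x

theorem IsAdmissible.exp_log_potential_consSeq (h : IsAdmissible g c) (a : A) (x : Seq A) :
    Real.exp (Real.log (potential g (consSeq a x))) = g 0 a * tailProduct g x := by
  have h1 : potential g (consSeq a x) = g 0 a * tailProduct g x :=
    tprod_eq_zero_mul' (f := fun n => g n (consSeq a x n)) (h.multipliable 1 x)
  rw [h1, Real.exp_log (mul_pos (h.pos 0 a) (h.tailProduct_pos x))]

theorem IsAdmissible.ruelle_eq (h : IsAdmissible g c) (φ : Seq A → ℝ) (x : Seq A) :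
    ruelle (fun x => Real.log (potential g x)) φ x =
      ∑' a, φ (consSeq a x) * (g 0 a * tailProduct g x) := by
  rw [ruelle, ← (shiftFiberEquiv x).tsum_eq]
  exact tsum_congr fun a => by rw [← h.exp_log_potential_consSeq]; rfl

theorem IsAdmissible.ruelleConverges_iff (h : IsAdmissible g c) (φ : Seq A → ℝ) (x : Seq A) :
    RuelleConverges (fun x => Real.log (potential g x)) φ x ↔
      Summable fun a => φ (consSeq a x) * (g 0 a * tailProduct g x) := by
  rw [RuelleConverges, ← (shiftFiberEquiv x).summable_iff]
  exact summable_congr fun a => by rw [← h.exp_log_potential_consSeq]; rfl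

theorem IsAdmissible.hPartial_succ_consSeq [Nonempty A] (h : IsAdmissible g c) (n : ℕ) (a : A)
    (x : Seq A) :
    hPartial g (n + 1) (consSeq a x) = hFactor g 0 a * ((∑' b, partialWeight g n b) /
      (∑' b, partialWeight g 0 b) * hPartial g n x / ∏ l ∈ Finset.range n, g (l + 1) (x l)) := by
  have hZ := fun n => (h.tsum_partialWeight_pos n).ne'
  -- Prepending a letter moves each letter of `x` one place on, where the tail product has lost the
  -- factor `g (j + 1)`.
  have hsucc : ∀ j b, hFactor g (j + 1) b = (∑' b, partialWeight g (j + 1) b) /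
      (∑' b, partialWeight g j b) * hFactor g j b / g (j + 1) b := by
    intro j b
    have e : ∏' l, g (l + 1 + j) b = g (j + 1) b * ∏' l, g (l + 1 + (j + 1)) b := by
      rw [tprod_eq_zero_mul' (f := fun l => g (l + 1 + j) b)]
      · congr 2
        · rw [zero_add, add_comm]
        · funext l
          congr 1
          ring
      · have := h.multipliable (1 + 1 + j) fun _ => b
        simpa only [← add_assoc] using this
    rw [hFactor, hFactor, e]
    have := hZ j
    have := (h.pos (j + 1) b).ne'
    field_simp
  have hprod : ∏ j ∈ Finset.range n, hFactor g (j + 1) (x j) = (∑' b, partialWeight g n b) /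
      (∑' b, partialWeight g 0 b) * hPartial g n x / ∏ l ∈ Finset.range n, g (l + 1) (x l) := by
    induction n with
    | zero => simp [hPartial, hZ]
    | succ n ih =>
      rw [Finset.prod_range_succ, ih, hsucc, hPartial, hPartial, Finset.prod_range_succ,
        Finset.prod_range_succ]
      have := hZ n
      have := hZ 0
      have := (h.pos (n + 1) (x n)).ne'
      have := (Finset.prod_pos fun l (_ : l ∈ Finset.range n) => h.pos (l + 1) (x l)).ne'
      field_simp
  rw [hPartial, Finset.prod_range_succ', mul_comm, ← hprod]
  rfl

/-- Convergence at `x` forces convergence at every preimage of `x`, so no null set has to be pulled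
back through the shift. -/
theorem IsAdmissible.hMu_consSeq_mul [Nonempty A] (h : IsAdmissible g c) {x : Seq A}
    (hx : Tendsto (fun n => hPartial g n x) atTop (𝓝 (hMu g x))) (a : A) :
    hMu g (consSeq a x) * (g 0 a * tailProduct g x) = fullWeight g a * hMu g x := by
  have hZ0 := (h.tsum_partialWeight_pos 0).ne'
  have hT := (h.tailProduct_pos x).ne'
  have hl : (∑' b, fullWeight g b) ≠ 0 := h.eigenvalue_pos.ne'
  have h1 : Tendsto (fun n => hPartial g (n + 1) (consSeq a x)) atTop
      (𝓝 (hFactor g 0 a * (eigenvalue g / (∑' b, partialWeight g 0 b) * hMu g x /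
        tailProduct g x))) := by
    simp_rw [h.hPartial_succ_consSeq]
    exact tendsto_const_nhds.mul (((h.tendsto_tsum_partialWeight.div_const _).mul hx).div
      (h.tendsto_tailProduct x) hT)
  have h2 : hMu g (consSeq a x) = _ := ((tendsto_add_atTop_iff_nat 1).1 h1).limUnder_eq
  rw [h2, h.fullWeight_eq 0 a, hFactor, eigenvalue, partialWeight]
  simp only [zero_add, Finset.prod_range_one]
  field_simp

theorem IsAdmissible.ruelleConverges_hMu [Nonempty A] (h : IsAdmissible g c) {x : Seq A}
    (hx : Tendsto (fun n => hPartial g n x) atTop (𝓝 (hMu g x))) :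
    RuelleConverges (fun x => Real.log (potential g x)) (hMu g) x := by
  rw [h.ruelleConverges_iff]
  simp_rw [h.hMu_consSeq_mul hx]
  exact h.summable_fullWeight.mul_right _

theorem IsAdmissible.ruelle_hMu [Nonempty A] (h : IsAdmissible g c) {x : Seq A}
    (hx : Tendsto (fun n => hPartial g n x) atTop (𝓝 (hMu g x))) :
    ruelle (fun x => Real.log (potential g x)) (hMu g) x = eigenvalue g * hMu g x := by
  rw [h.ruelle_eq]
  simp_rw [h.hMu_consSeq_mul hx]
  exact tsum_mul_right

end Ruelle

/-! ### Shift-invariance of eigenfunctions and uniqueness. -/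

section Uniqueness

theorem measurable_shift {X : Type*} [MeasurableSpace X] : Measurable (shift : Seq X → Seq X) :=
  measurable_pi_iff.2 fun n => measurable_pi_apply (n + 1)

theorem measurable_consSeq {X : Type*} [MeasurableSpace X] :
    Measurable fun p : X × Seq X => consSeq p.1 p.2 := by
  refine measurable_pi_iff.2 fun n => ?_
  cases n with
  | zero => exact measurable_fst
  | succ n => exact (measurable_pi_apply n).comp measurable_snd

theorem shift_iterate_apply {X : Type*} (n : ℕ) (x : Seq X) (i : ℕ) :
    (shift^[n] x) i = x (n + i) := by
  induction n generalizing x with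
  | zero => simp
  | succ n ih =>
    rw [Function.iterate_succ_apply, ih, shift]
    congr 1
    ring

/-- An infinite product measure is the product of its first marginal and the product of the
others. -/
theorem measurePreserving_consSeq {X : Type*} [MeasurableSpace X] (P : ℕ → Measure X)
    [∀ n, IsProbabilityMeasure (P n)] :
    MeasurePreserving (fun p : X × Seq X => consSeq p.1 p.2)
      ((P 0).prod (Measure.infinitePi fun n => P (n + 1))) (Measure.infinitePi P) := by
  refine ⟨measurable_consSeq, ?_⟩
  have hind : IndepFun (fun x : Seq X => x 0) shift (Measure.infinitePi P) := by
    rw [IndepFun_iff_Indep]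
    refine indep_of_indep_of_le_left (indep_of_indep_of_le_right
      (indep_coordFiltration_tail P 1) ?_) ?_
    · have h1 := (measurable_shift_iterate_tail (X := X) 1).comap_le
      have h2 : (fun (x : ℕ → X) i => x (1 + i)) = shift := by
        funext x i
        rw [add_comm]
        rfl
      rwa [h2] at h1
    · exact (measurable_coordFiltration Nat.zero_lt_one).comap_le
  have hmap := hind.map_prod_eq_prod_map_map (measurable_pi_apply 0).aemeasurable
    measurable_shift.aemeasurable
  have hs : (Measure.infinitePi P).map shift = Measure.infinitePi fun n => P (n + 1) :=
    Measure.map_infinitePi_infinitePi_of_inj (P := P) (add_left_injective 1)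
  rw [Measure.infinitePi_map_eval, hs] at hmap
  -- By independence the product is the image of the infinite product under `x ↦ (x 0, shift x)`,
  -- which `consSeq` inverts.
  rw [← hmap, Measure.map_map measurable_consSeq ((measurable_pi_apply 0).prodMk measurable_shift)]
  convert Measure.map_id using 2
  funext x
  exact consSeq_shift x

/-- A function integrable for an infinite product measure whose integral over every measurable
set is preserved by the shift is determined by its integral. -/
theorem ae_eq_of_shift_invariant {X : Type*} [MeasurableSpace X] (P : ℕ → Measure X)
    [∀ n, IsProbabilityMeasure (P n)] {h₁ h₂ : Seq X → ℝ}
    (hi₁ : Integrable h₁ (Measure.infinitePi P)) (hi₂ : Integrable h₂ (Measure.infinitePi P))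
    (hs₁ : ∀ B, MeasurableSet B → ∫ x in shift ⁻¹' B, h₁ x ∂Measure.infinitePi P
      = ∫ x in B, h₁ x ∂Measure.infinitePi P)
    (hs₂ : ∀ B, MeasurableSet B → ∫ x in shift ⁻¹' B, h₂ x ∂Measure.infinitePi P
      = ∫ x in B, h₂ x ∂Measure.infinitePi P)
    (hInt : ∫ x, h₁ x ∂Measure.infinitePi P = ∫ x, h₂ x ∂Measure.infinitePi P) :
    h₁ =ᵐ[Measure.infinitePi P] h₂ := by
  set μ := Measure.infinitePi P
  set f := h₁ - h₂
  have hf : Integrable f μ := hi₁.sub hi₂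
  have hs : ∀ B, MeasurableSet B → ∫ x in shift ⁻¹' B, f x ∂μ = ∫ x in B, f x ∂μ := by
    intro B hB
    simp only [f, Pi.sub_apply]
    rw [integral_sub hi₁.integrableOn hi₂.integrableOn,
      integral_sub hi₁.integrableOn hi₂.integrableOn, hs₁ B hB, hs₂ B hB]
  have hsn : ∀ n B, MeasurableSet B →
      ∫ x in shift^[n] ⁻¹' B, f x ∂μ = ∫ x in B, f x ∂μ := by
    intro n
    induction n with
    | zero => intro B _; rfl
    | succ n ih =>
      intro B hB
      rw [Function.iterate_succ', Set.preimage_comp, ih _ (measurable_shift hB), hs B hB]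
  have hf0 : ∫ x, f x ∂μ = 0 := by
    simp only [f, Pi.sub_apply]
    rw [integral_sub hi₁ hi₂, hInt, sub_self]
  have hmain : ∀ B, MeasurableSet B → ∫ x in B, f x ∂μ = 0 := by
    intro B hB
    -- The left side does not depend on `n`, while the right side tends to zero by Lévy's upward
    -- theorem.
    have hbound : ∀ n, ENNReal.ofReal |∫ x in B, f x ∂μ|
        ≤ eLpNorm (μ[f | coordFiltration (X := X) n] - f) 1 μ := by
      intro n
      have hle : (⨆ i ∈ Set.Ici n, MeasurableSpace.comap (fun x : ℕ → X => x i) inferInstance)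
          ≤ MeasurableSpace.pi := iSup₂_le fun i _ => (measurable_pi_apply i).comap_le
      have hS : MeasurableSet[⨆ i ∈ Set.Ici n,
          MeasurableSpace.comap (fun x : ℕ → X => x i) inferInstance] (shift^[n] ⁻¹' B) := by
        have h1 := measurable_shift_iterate_tail (X := X) n hB
        have h2 : (fun (x : ℕ → X) i => x (n + i)) = shift^[n] := by
          funext x i
          exact (shift_iterate_apply n x i).symm
        rwa [h2] at h1
      have h0 : ∫ x in shift^[n] ⁻¹' B, (μ[f | coordFiltration (X := X) n]) x ∂μ = 0 := by
        -- Conditioning the conditional expectation once more, on the independent tail, leaves the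
        -- constant `∫ f = 0`.
        rw [← setIntegral_condExp hle integrable_condExp hS]
        have h3 := condExp_indep_eq (μ := μ) (f := μ[f | coordFiltration (X := X) n])
          (coordFiltration.le n) hle stronglyMeasurable_condExp (indep_coordFiltration_tail P n)
        rw [integral_congr_ae (ae_restrict_of_ae h3), integral_condExp (coordFiltration.le n), hf0]
        simp
      rw [← hsn n B hB, ← abs_neg, ← zero_sub, ← h0,
        ← integral_sub integrable_condExp.integrableOn hf.integrableOn,
        ← Real.enorm_eq_ofReal_abs, eLpNorm_one_eq_lintegral_enorm]
      exact (enorm_integral_le_lintegral_enorm _).trans (setLIntegral_le_lintegral _ _)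
    have hlim := tendsto_eLpNorm_condExp (μ := μ) (ℱ := coordFiltration (X := X)) f
    rw [iSup_coordFiltration] at hlim
    have hself : μ[f | MeasurableSpace.pi] =ᵐ[μ] f :=
      condExp_of_aestronglyMeasurable' le_rfl hf.1 hf
    have hzero : ENNReal.ofReal |∫ x in B, f x ∂μ| ≤ 0 := by
      refine ge_of_tendsto' hlim fun n => ?_
      rw [eLpNorm_congr_ae ((EventuallyEq.refl _ _).sub hself)]
      exact hbound n
    simpa using hzero
  refine hi₁.ae_eq_of_forall_setIntegral_eq h₁ h₂ hi₂ fun B hB _ => ?_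
  have h1 := hmain B hB
  simp only [f, Pi.sub_apply] at h1
  rwa [integral_sub hi₁.integrableOn hi₂.integrableOn, sub_eq_zero] at h1

variable {A : Type*} [Nonempty A] [Countable A] [MeasurableSpace A] [MeasurableSingletonClass A]
  {g : ℕ → A → ℝ} {c : ℕ → ℝ}

/-- Integrating out the first letter produces the Ruelle operator divided by `Z * tailProduct`. The
density of the shifted measure cancels this divisor and the eigenvalue. -/
theorem IsAdmissible.setIntegral_shift_preimage (h : IsAdmissible g c) {f : Seq A → ℝ}
    (hf : Integrable f (conformalMeasure g))
    (heig : ruelle (fun x => Real.log (potential g x)) f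
        =ᵐ[conformalMeasure g] fun x => eigenvalue g * f x) {B : Set (Seq A)}
    (hB : MeasurableSet B) :
    ∫ x in shift ⁻¹' B, f x ∂conformalMeasure g = ∫ x in B, f x ∂conformalMeasure g := by
  have := h.isProbabilityMeasure_partialWeight
  set P : ℕ → Measure A := fun n => normalizedMeasure (partialWeight g n) with hP
  set ν := Measure.infinitePi fun n => P (n + 1) with hν
  have hcons : MeasurePreserving (fun p : A × Seq A => consSeq p.1 p.2) ((P 0).prod ν)
    (conformalMeasure g) := measurePreserving_consSeq P
  have hνd : ν = _ := h.infinitePi_succ_eq_withDensity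
  set Z := ∑' b, partialWeight g 0 b with hZdef
  have hZ : 0 < Z := h.tsum_partialWeight_pos 0
  have hl := h.eigenvalue_pos
  have hTm : Measurable (tailProduct g) := by
    refine measurable_of_tendsto_metrizable (f := fun n x => ∏ l ∈ Finset.range n, g (l + 1) (x l))
      (fun n => ?_) (tendsto_pi_nhds.2 h.tendsto_tailProduct)
    exact Finset.measurable_fun_prod _ fun l _ =>
      (measurable_of_countable (g (l + 1))).comp (measurable_pi_apply l)
  -- Needed to transfer the eigenvalue equation from `μ`-a.e. to `ν`-a.e. points.
  have hac : ν ≪ conformalMeasure g := by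
    rw [hνd]
    exact withDensity_absolutelyContinuous _ _
  have hfi : Integrable ((shift ⁻¹' B).indicator f) (conformalMeasure g) :=
    hf.indicator (measurable_shift hB)
  have hfc : Integrable (fun p : A × Seq A => f (consSeq p.1 p.2)) ((P 0).prod ν) :=
    hcons.integrable_comp_of_integrable hf
  have hfci : Integrable (fun p : A × Seq A => (shift ⁻¹' B).indicator f (consSeq p.1 p.2))
    ((P 0).prod ν) := hcons.integrable_comp_of_integrable hfi
  have hinner : ∀ᵐ y ∂ν, ∫ a, (shift ⁻¹' B).indicator f (consSeq a y) ∂P 0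
      = B.indicator (fun y => eigenvalue g * f y / (Z * tailProduct g y)) y := by
    filter_upwards [hfc.swap.prod_right_ae, hac.ae_le heig] with y hy hye
    by_cases hyB : y ∈ B
    · have e : ∀ a, (shift ⁻¹' B).indicator f (consSeq a y) = f (consSeq a y) := fun a =>
        Set.indicator_of_mem (s := shift ⁻¹' B) hyB f
      simp_rw [e]
      replace hy : Integrable (fun a => f (consSeq a y)) (P 0) := hy
      rw [integral_countable hy, Set.indicator_of_mem hyB, ← hye, h.ruelle_eq, ← tsum_div_const]
      refine tsum_congr fun a => ?_
      have hT := (h.tailProduct_pos y).ne'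
      have h0 : 0 ≤ partialWeight g 0 a / Z := (div_pos (h.partialWeight_pos 0 a) hZ).le
      rw [Measure.real, normalizedMeasure_singleton, ENNReal.toReal_ofReal h0, smul_eq_mul,
        partialWeight, zero_add, Finset.prod_range_one]
      have := hZ.ne'
      field_simp
    · have e : ∀ a, (shift ⁻¹' B).indicator f (consSeq a y) = 0 := fun a =>
        Set.indicator_of_notMem (s := shift ⁻¹' B) hyB f
      simp [e, hyB]
  rw [← integral_indicator (measurable_shift hB), ← integral_indicator hB]
  calc ∫ x, (shift ⁻¹' B).indicator f x ∂conformalMeasure g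
      = ∫ p, (shift ⁻¹' B).indicator f (consSeq p.1 p.2) ∂(P 0).prod ν := by
        rw [← hcons.map_eq, integral_map hcons.aemeasurable]
        rw [hcons.map_eq]
        exact hfi.1
    _ = ∫ y, ∫ a, (shift ⁻¹' B).indicator f (consSeq a y) ∂P 0 ∂ν := integral_prod_symm _ hfci
    _ = ∫ y, B.indicator (fun y => eigenvalue g * f y / (Z * tailProduct g y)) y ∂ν :=
        integral_congr_ae hinner
    _ = ∫ y, B.indicator f y ∂conformalMeasure g := by
        rw [hνd, integral_withDensity_eq_integral_toReal_smul (by fun_prop)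
          (ae_of_all _ fun _ => ENNReal.ofReal_lt_top)]
        refine integral_congr_ae (ae_of_all _ fun y => ?_)
        have hT := h.tailProduct_pos y
        simp only
        rw [ENNReal.toReal_ofReal (by positivity), smul_eq_mul]
        by_cases hyB : y ∈ B
        · simp only [Set.indicator_of_mem hyB]
          field_simp
        · simp [hyB]

end Uniqueness

end ProductPotential

/-! ### Assembly of the three claims. -/

open ProductPotential in
theorem theorem4p3 {A : Type*} [Nonempty A] [Countable A] [MeasurableSpace A]
    [MeasurableSingletonClass A] (g : ℕ → A → ℝ) (hpos : ∀ n a, 0 < g n a)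
    (hbdd : L1Bounded g) (hsum : SummablePotential g) :
    -- uniqueness of the normalized eigenfunction in `L¹(μ)`
    (∀ h₁ h₂ : Seq A → ℝ,
      Integrable h₁ (conformalMeasure g) → Integrable h₂ (conformalMeasure g) →
      (ruelle (fun x => Real.log (potential g x)) h₁
        =ᵐ[conformalMeasure g] fun x => eigenvalue g * h₁ x) →
      (ruelle (fun x => Real.log (potential g x)) h₂
        =ᵐ[conformalMeasure g] fun x => eigenvalue g * h₂ x) →
      ∫ x, h₁ x ∂(conformalMeasure g) = 1 → ∫ x, h₂ x ∂(conformalMeasure g) = 1 →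
      h₁ =ᵐ[conformalMeasure g] h₂) ∧
    -- the explicit eigenfunction under `ℓ₂`-bounded tails
    (L2BoundedTails g →
      Integrable (hMu g) (conformalMeasure g) ∧
      ∫ x, hMu g x ∂(conformalMeasure g) = 1 ∧
      (∀ᵐ x ∂(conformalMeasure g),
        RuelleConverges (fun x => Real.log (potential g x)) (hMu g) x) ∧
      (ruelle (fun x => Real.log (potential g x)) (hMu g)
        =ᵐ[conformalMeasure g] fun x => eigenvalue g * hMu g x) ∧
      equilibriumMeasure g =
        (conformalMeasure g).withDensity fun x => ENNReal.ofReal (hMu g x)) ∧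
    -- almost sure existence of `h_μ` and the dichotomy
    ((∀ᵐ x ∂(conformalMeasure g),
        Tendsto (fun n => hPartial g n x) atTop (𝓝 (hMu g x))) ∧
      Integrable (hMu g) (conformalMeasure g) ∧
      (0 < ∫ x, hMu g x ∂(conformalMeasure g) ↔
        conformalMeasure g ≪ equilibriumMeasure g ∧
        equilibriumMeasure g ≪ conformalMeasure g) ∧
      (∫ x, hMu g x ∂(conformalMeasure g) = 0 →
        Measure.MutuallySingular (equilibriumMeasure g) (conformalMeasure g))) := by
  obtain ⟨c, h⟩ := exists_isAdmissible hpos hbdd hsum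
  have := h.isProbabilityMeasure_partialWeight
  have := h.isProbabilityMeasure_fullWeight
  have hμ : IsProbabilityMeasure (conformalMeasure g) := by
    unfold conformalMeasure
    infer_instance
  have hν : IsProbabilityMeasure (equilibriumMeasure g) := by
    unfold equilibriumMeasure
    infer_instance
  have hd := h.isPosDensity_hFactor
  have hlim : ∀ᵐ x ∂(conformalMeasure g),
      Tendsto (fun n => hPartial g n x) atTop (𝓝 (hMu g x)) := by
    filter_upwards [ae_exists_tendsto_partialDensity hd] with x hx
    exact tendsto_nhds_limUnder hx
  have hnn : ∀ᵐ x ∂(conformalMeasure g), 0 ≤ hMu g x := by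
    filter_upwards [hlim] with x hx
    exact ge_of_tendsto' hx fun n => (partialDensity_pos hd n x).le
  have hInt : Integrable (hMu g) (conformalMeasure g) := by
    refine ⟨(aemeasurable_limit hd hlim).aestronglyMeasurable, ?_⟩
    rw [hasFiniteIntegral_iff_ofReal hnn]
    have h1 := lintegral_comp_limit_le hlim (F := fun _ y => y) (S := Set.univ) (b := 1)
      (fun _ => continuous_id) (measurable_partialDensity hd)
      (Eventually.of_forall fun n => by
        rw [Measure.restrict_univ]
        exact (lintegral_partialDensity hd n).le)
    rw [Measure.restrict_univ] at h1
    exact h1.trans_lt ENNReal.one_lt_top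
  have hdens : AffinityConverges (fun n => normalizedMeasure (partialWeight g n)) (hFactor g) →
      equilibriumMeasure g =
        (conformalMeasure g).withDensity fun x => ENNReal.ofReal (hMu g x) := fun hr =>
    infinitePi_eq_withDensity hd hlim hr
  have hone : AffinityConverges (fun n => normalizedMeasure (partialWeight g n)) (hFactor g) →
      ∫ x, hMu g x ∂(conformalMeasure g) = 1 := by
    intro hr
    have h1 : equilibriumMeasure g Set.univ = 1 := measure_univ
    rw [hdens hr, withDensity_apply _ MeasurableSet.univ, Measure.restrict_univ] at h1
    rw [integral_eq_lintegral_of_nonneg_ae hnn hInt.1, h1, ENNReal.toReal_one]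
  refine ⟨fun h₁ h₂ hi₁ hi₂ he₁ he₂ ho₁ ho₂ => ?_, fun h2 => ?_, hlim, hInt, ?_⟩
  · exact ae_eq_of_shift_invariant _ hi₁ hi₂ (fun B hB => h.setIntegral_shift_preimage hi₁ he₁ hB)
      (fun B hB => h.setIntegral_shift_preimage hi₂ he₂ hB) (ho₁.trans ho₂.symm)
  · have hr := h.affinityConverges_hFactor h2
    exact ⟨hInt, hone hr, hlim.mono fun x hx => h.ruelleConverges_hMu hx,
      hlim.mono fun x hx => h.ruelle_hMu hx, hdens hr⟩
  rcases affinityConverges_or_tendsto_zero hd with hr | hr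
  -- Here the integral is one and the measures are equivalent; in the other case it is zero and they
  -- are singular. Each equivalence follows by comparing the two cases.
  · refine ⟨⟨fun _ => ⟨?_, ?_⟩, fun _ => ?_⟩, fun h0 => ?_⟩
    · exact infinitePi_absolutelyContinuous hd.symm (hr.symm hd)
    · exact infinitePi_absolutelyContinuous hd hr
    · rw [hone hr]
      exact one_pos
    · rw [hone hr] at h0
      exact absurd h0 one_ne_zero
  · have hsing : Measure.MutuallySingular (equilibriumMeasure g) (conformalMeasure g) :=
      mutuallySingular_infinitePi hd hr
    have hzero : ∫ x, hMu g x ∂(conformalMeasure g) = 0 :=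
      integral_eq_zero_of_ae (ae_limit_eq_zero hd hlim hr)
    refine ⟨⟨fun h0 => absurd hzero h0.ne', fun hac => ?_⟩, fun _ => hsing⟩
    exact absurd (Measure.eq_zero_of_absolutelyContinuous_of_mutuallySingular hac.2 hsing)
      (IsProbabilityMeasure.ne_zero _)
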